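/- Let $\Gamma=\{(\tau,\xi)\in\mathbb{R}\times\mathbb{R}^{2}: 1+\tau^2=|\xi|^2\}$ be the one-sheeted hyperboloid, equipped with the Lorentz-invariant measure $$\int_\Gamma f\,d\sigma=\int_{\{|\xi|>1\}}\Big(f\big(-\sqrt{|\xi|^2-1},\xi\big)+f\big(\sqrt{|\xi|^2-1},\xi\big)\Big)\frac{d\xi}{\sqrt{|\xi|^2-1}},$$ and let $\mathcal{E}f(t,x)=\int_\Gamma e^{i(t\tau+x\cdot\xi)}f(\tau,\xi)\,d\sigma(\tau,\xi)$, $(t,x)\in\mathbb{R}\times\mathbb{R}^2$, be the associated Fourier extension operator. Let $p,q\in[1,\infty]$ satisfy $q=3p'$, where $\frac1p+\frac1{p'}=1$, together with $q\ge p$ and $(p,q)\neq(4,4)$ (equivalently, $1\le p<4$ and $q=3p'$, with $q=\infty$ if $p=1$). Then there is a constant $C<\infty$, depending only on $p$ and $q$, such that $$\|\mathcal{E}f\|_{L^q(\mathbb{R}^3)}\le C\,\|f\|_{L^p(\Gamma;d\sigma)}\qquad\text{for all complex-valued } f\in C^\infty_{c}(\mathbb{R}^3).$$ -/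

import Mathlib

open MeasureTheory
open scoped ENNReal NNReal ContDiff

/-- The space-time `ℝ^{1+2}`, with points `(τ, ξ)` on the frequency side and `(t, x)` on the
physical side. Its `volume` is the product of the Lebesgue measures, i.e. Lebesgue measure
on `ℝ³`. -/
abbrev SpaceTime : Type := ℝ × EuclideanSpace ℝ (Fin 2)

/-- `√(|ξ|² - 1)`, used for `|ξ| ≥ 1`. -/
noncomputable def hypBracket (ξ : EuclideanSpace ℝ (Fin 2)) : ℝ :=
  Real.sqrt (‖ξ‖ ^ 2 - 1)

/-- The one-sheeted hyperboloid `Γ = {(τ, ξ) : 1 + τ² = |ξ|²}`. -/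
def hyperboloid : Set SpaceTime :=
  {ζ | 1 + ζ.1 ^ 2 = ‖ζ.2‖ ^ 2}

/-- The measure `dξ / √(|ξ|² - 1)` on the region `{|ξ| > 1}` of the plane. -/
noncomputable def hypPlaneMeasure : Measure (EuclideanSpace ℝ (Fin 2)) :=
  (volume.restrict {ξ | 1 < ‖ξ‖}).withDensity fun ξ => ENNReal.ofReal (1 / hypBracket ξ)

/-- The Lorentz-invariant (affine surface) measure `σ` of the hyperboloid `Γ`, as a measure on
`ℝ^{1+2}` carried by `Γ`:
`∫ f dσ = ∫_{|ξ| > 1} (f(-√(|ξ|²-1), ξ) + f(√(|ξ|²-1), ξ)) dξ / √(|ξ|²-1)`. -/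
noncomputable def hypMeasure : Measure SpaceTime :=
  hypPlaneMeasure.map (fun ξ => (-hypBracket ξ, ξ)) +
    hypPlaneMeasure.map (fun ξ => (hypBracket ξ, ξ))

/-- The Fourier extension operator
`(ℰ f)(t, x) = ∫_Γ e^{i (t τ + x · ξ)} f(τ, ξ) dσ(τ, ξ)`. -/
noncomputable def hypExtension (f : SpaceTime → ℂ) (z : SpaceTime) : ℂ :=
  ∫ ζ in hyperboloid,
    Complex.exp (Complex.I * ((z.1 * ζ.1 + inner ℝ z.2 ζ.2 : ℝ) : ℂ)) * f ζ ∂hypMeasure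

/-- The extension estimate `ℛ*(p → q)`: there is a constant `C` such that
`‖ℰ f‖_{L^q(ℝ³)} ≤ C ‖f‖_{L^p(Γ; dσ)}` for every `f ∈ C_c^∞(ℝ³)`. -/
def ExtensionEstimate (p q : ℝ≥0∞) : Prop :=
  ∃ C : ℝ≥0, ∀ f : SpaceTime → ℂ, ContDiff ℝ ∞ f → HasCompactSupport f →
    eLpNorm (hypExtension f) q volume ≤ C * eLpNorm f p (hypMeasure.restrict hyperboloid)

/-! Slice `Γ` by the hyperplanes `ξ₁ = ξ`. Each slice is a hyperbola of radius `m = √|ξ² - 1|`, and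
with its hyperbolic angle `s` as second coordinate the invariant measure becomes `dξ ds`
(`hypMeasure_eq_sum`). This gives four pieces, according to whether `|ξ| > 1` and to the branch of
the hyperbola. A permutation and reflection of the physical variables reduces each of them to the
same operator `hypOp` on functions `g (ξ, s)` on the plane.

The core is a weak-type bound for `2 ≤ p < 4` (`hypOp_weak_type`). Write `hypOp g ^ 2` as an
integral over pairs `(ξ, s), (η, t)`, put `u = |g|^p` and `β(ξ) = ∫ u(ξ, s) ds`, and call a pair far
if `|s - t|` is at least `κ β(η) u(ξ, s)` and at least `κ β(ξ) u(η, t)`. The near pairs contribute a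
function bounded by a multiple of `κ^(1 - 1/p) (∫ u)²`, by Hölder alone. The far pairs are
controlled in `L²` by Plancherel and duality. For fixed `ξ, η` the sum of two points of the
hyperbolas has Jacobian `m m' |sinh (s - t)|`, so Cauchy–Schwarz leaves the integral of `(u v)^(2/p)
/ (m m' |s - t|)`, which the far condition makes finite exactly because `a = 2/p - 1/2 > 0`. What
remains in `ξ, η` is a scale-invariant convolution inequality with weights `|ξ² - 1|^(-1/4)`
(`lintegral_hypWeight_conv_le`). Choosing `κ` so that the near part is at most half of `l²` and
applying Chebyshev to the far part gives the bound on `{|hypOp g| > l}`.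

Real interpolation with the trivial `L¹ → L^∞` bound turns this into the strong-type bound for all
`1 < p < 4` (`hypOp_strong_type`). The four pieces are then added, and `p = 1` is the trivial bound
itself. -/

/-! ### Plancherel's theorem for the Fourier integral -/

open FourierTransform in
/-- The Fourier integral of a function in `L¹ ∩ L²` is its `L²` Fourier transform. -/
theorem fourier_ae_eq_of_integrable_memLp {E : Type*} [NormedAddCommGroup E]
    [InnerProductSpace ℝ E] [FiniteDimensional ℝ E] [MeasurableSpace E] [BorelSpace E]
    {f : E → ℂ} (hf : Integrable f) (hf2 : MemLp f 2) :
    (𝓕 (hf2.toLp f) : Lp (α := E) ℂ 2 volume) =ᵐ[volume] 𝓕 f := by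
  have hcont : Continuous (𝓕 f) :=
    VectorFourier.fourierIntegral_continuous Real.continuous_fourierChar
      (by exact continuous_inner) hf
  -- Both sides are tested against smooth compactly supported functions. These are Schwartz, so the
  -- `L²` transform can be moved onto them as a tempered distribution, and the Fourier integral by
  -- Fubini.
  apply ae_eq_of_integral_contDiff_smul_eq
  · exact (Lp.memLp (𝓕 (hf2.toLp f) : Lp (α := E) ℂ 2 volume)).locallyIntegrable (by norm_num)
  · exact hcont.locallyIntegrable
  intro g hg hgc
  have hg1 : HasCompactSupport (Complex.ofRealCLM ∘ g) := hgc.comp_left rfl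
  have hg2 : ContDiff ℝ ∞ (Complex.ofRealCLM ∘ g) := by fun_prop
  set G : SchwartzMap E ℂ := hg1.toSchwartzMap hg2 with hG
  have hGa : ∀ x, G x = (g x : ℂ) := fun x => by simp [hG]
  have key := congrArg (fun T : TemperedDistribution E ℂ => T G)
    (Lp.fourier_toTemperedDistribution_eq (hf2.toLp f))
  simp only [TemperedDistribution.fourier_apply, Lp.toTemperedDistribution_apply] at key
  have e1 : ∫ x, g x • (𝓕 (hf2.toLp f) : Lp (α := E) ℂ 2 volume) x
      = ∫ x, G x • (𝓕 (hf2.toLp f) : Lp (α := E) ℂ 2 volume) x := by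
    simp [hGa]
  have e2 : ∫ x, g x • 𝓕 f x = ∫ x, G x • 𝓕 f x := by simp [hGa]
  rw [e1, e2, ← key]
  have e3 : ∫ x, (𝓕 G) x • (hf2.toLp f) x = ∫ x, (𝓕 G) x • f x := by
    apply integral_congr_ae
    filter_upwards [hf2.coeFn_toLp] with x hx
    rw [hx]
  rw [e3]
  have := VectorFourier.integral_fourierIntegral_smul_eq_flip (μ := volume) (ν := volume)
    (L := innerₗ E) (f := f) (g := G) Real.continuous_fourierChar
    (by exact continuous_inner) hf (G.integrable)
  rw [flip_innerₗ] at this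
  have h4 : ∫ x, 𝓕 f x • G x = ∫ x, f x • (𝓕 (G : E → ℂ)) x := this
  simp only [smul_eq_mul] at h4 ⊢
  simp only [mul_comm (G _), h4, SchwartzMap.fourier_coe]
  simp only [mul_comm]

open FourierTransform in
theorem lintegral_enorm_fourier_sq {E : Type*} [NormedAddCommGroup E]
    [InnerProductSpace ℝ E] [FiniteDimensional ℝ E] [MeasurableSpace E] [BorelSpace E]
    {f : E → ℂ} (hf : Integrable f) (hf2 : MemLp f 2) :
    ∫⁻ w, ‖𝓕 f w‖ₑ ^ 2 = ∫⁻ v, ‖f v‖ₑ ^ 2 := by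
  have h : eLpNorm (𝓕 f) 2 volume = eLpNorm f 2 volume := by
    rw [← eLpNorm_congr_ae (fourier_ae_eq_of_integrable_memLp hf hf2),
      ← eLpNorm_congr_ae hf2.coeFn_toLp, ← Lp.enorm_def, ← Lp.enorm_def, ← ofReal_norm,
      ← ofReal_norm, Lp.norm_fourier_eq]
  rw [eLpNorm_eq_lintegral_rpow_enorm_toReal (by norm_num) (by norm_num),
    eLpNorm_eq_lintegral_rpow_enorm_toReal (by norm_num) (by norm_num)] at h
  have := (ENNReal.rpow_left_injective (x := 1 / (2 : ℝ≥0∞).toReal) (by simp)) h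
  simpa using this

/-- The pairing `x · w` of `ℝ³ = ℝ × ℝ × ℝ`. -/
def dot3 (z w : ℝ × ℝ × ℝ) : ℝ := z.1 * w.1 + z.2.1 * w.2.1 + z.2.2 * w.2.2

@[fun_prop]
theorem continuous_dot3 : Continuous fun x : (ℝ × ℝ × ℝ) × (ℝ × ℝ × ℝ) => dot3 x.1 x.2 := by
  unfold dot3; fun_prop

@[fun_prop]
theorem Measurable.dot3 {α : Type*} [MeasurableSpace α] {f g : α → ℝ × ℝ × ℝ} (hf : Measurable f)
    (hg : Measurable g) : Measurable fun a => dot3 (f a) (g a) :=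
  continuous_dot3.measurable.comp (hf.prodMk hg)

theorem dot3_add (z w w' : ℝ × ℝ × ℝ) : dot3 z (w + w') = dot3 z w + dot3 z w' := by
  simp only [dot3, Prod.fst_add, Prod.snd_add]; ring

/-- The Euclidean model of `ℝ × ℝ × ℝ`. -/
abbrev E3 := WithLp 2 (ℝ × WithLp 2 (ℝ × ℝ))

/-- The identification of `ℝ × ℝ × ℝ` with its Euclidean model. -/
def toE3 : ℝ × ℝ × ℝ ≃ᵐ E3 :=
  (MeasurableEquiv.prodCongr (MeasurableEquiv.refl ℝ) (MeasurableEquiv.toLp 2 (ℝ × ℝ))).trans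
    (MeasurableEquiv.toLp 2 (ℝ × WithLp 2 (ℝ × ℝ)))

theorem measurePreserving_toE3 : MeasurePreserving toE3 := by
  refine MeasurePreserving.trans (β := ℝ × WithLp 2 (ℝ × ℝ)) ?_
    (WithLp.volume_preserving_toLp ℝ (WithLp 2 (ℝ × ℝ)))
  exact (MeasurePreserving.id volume).prod (WithLp.volume_preserving_toLp ℝ ℝ)

theorem inner_toE3 (z w : ℝ × ℝ × ℝ) : inner ℝ (toE3 z) (toE3 w) = dot3 z w := by
  have h1 : ∀ a : ℝ × ℝ × ℝ, toE3 a = WithLp.toLp 2 (a.1, WithLp.toLp 2 a.2) := fun _ => rfl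
  simp only [h1, WithLp.prod_inner_apply, dot3]
  simp; ring

/-- Plancherel's inequality for the unnormalized Fourier integral on `ℝ × ℝ × ℝ`. -/
theorem lintegral_enorm_fourierExp_sq_le {φ : ℝ × ℝ × ℝ → ℂ} (hf : Integrable φ)
    (hf2 : MemLp φ 2) :
    ∫⁻ w, ‖∫ z, Complex.exp (Complex.I * (dot3 z w : ℝ)) * φ z‖ₑ ^ 2
      ≤ ENNReal.ofReal ((2 * Real.pi) ^ 3) * ∫⁻ z, ‖φ z‖ₑ ^ 2 := by
  have hs := measurePreserving_toE3.symm
  -- `ℝ × ℝ × ℝ` carries the sup norm, so the transform is taken on its Euclidean model.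
  set ψ : E3 → ℂ := φ ∘ toE3.symm with hψ
  have hψi : Integrable ψ := (hs.integrable_comp_emb toE3.symm.measurableEmbedding).2 hf
  have hψ2 : MemLp ψ 2 := hf2.comp_measurePreserving hs
  have hp := Real.pi_pos
  -- The kernel of `FourierTransform.fourier` is `exp (-2πi ⟨v, w⟩)`. Dilating the frequency by
  -- `-(2π)⁻¹` matches the two conventions and costs the factor `(2π)³`.
  have e1 : ∀ w, ∫ z, Complex.exp (Complex.I * (dot3 z w : ℝ)) * φ z
      = FourierTransform.fourier ψ (toE3 ((-(2 * Real.pi)⁻¹) • w)) := by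
    intro w
    rw [Real.fourier_eq', ← measurePreserving_toE3.integral_comp toE3.measurableEmbedding]
    congr 1; ext z
    simp only [inner_toE3, hψ, Function.comp_apply, MeasurableEquiv.symm_apply_apply, smul_eq_mul]
    congr 2
    have : dot3 z (-(2 * Real.pi)⁻¹ • w) = -(2 * Real.pi)⁻¹ * dot3 z w := by
      simp [dot3]; ring
    rw [this]; push_cast
    have : (Real.pi : ℂ) ≠ 0 := by exact_mod_cast hp.ne'
    field_simp
  have : (volume : Measure (ℝ × ℝ × ℝ)).IsAddHaarMeasure :=
    Measure.prod.instIsAddHaarMeasure (volume : Measure ℝ) ((volume : Measure ℝ).prod volume)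
  have hfin : Module.finrank ℝ (ℝ × ℝ × ℝ) = 3 := by simp
  have hc : (-(2 * Real.pi)⁻¹ : ℝ) ≠ 0 := by
    simp [hp.ne']
  set H : ℝ × ℝ × ℝ → ℝ≥0∞ := fun w => ‖FourierTransform.fourier ψ (toE3 w)‖ₑ ^ 2 with hH
  calc ∫⁻ w, ‖∫ z, Complex.exp (Complex.I * (dot3 z w : ℝ)) * φ z‖ₑ ^ 2
      = ∫⁻ w, H ((-(2 * Real.pi)⁻¹ : ℝ) • w) := by simp_rw [e1, hH]
    _ = ∫⁻ w, H w ∂(Measure.map ((-(2 * Real.pi)⁻¹ : ℝ) • ·) volume) := by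
        rw [(Homeomorph.smulOfNeZero _ hc).measurableEmbedding.lintegral_map (f := H)
            (g := (((-(2 * Real.pi)⁻¹ : ℝ)) • ·))]
    _ = ENNReal.ofReal ((2 * Real.pi) ^ 3) * ∫⁻ w, H w := by
        rw [Measure.map_addHaar_smul volume hc, lintegral_smul_measure, hfin, smul_eq_mul]
        congr 2
        rw [abs_inv, abs_pow, abs_neg, abs_inv, abs_of_pos (by positivity), inv_pow, inv_inv]
    _ = ENNReal.ofReal ((2 * Real.pi) ^ 3) * ∫⁻ z, ‖φ z‖ₑ ^ 2 := by
        congr 1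
        rw [measurePreserving_toE3.lintegral_comp_emb toE3.measurableEmbedding
          (fun x => ‖FourierTransform.fourier ψ x‖ₑ ^ 2),
          lintegral_enorm_fourier_sq hψi hψ2, hψ,
          ← measurePreserving_toE3.lintegral_comp_emb toE3.measurableEmbedding]
        simp
    _ ≤ _ := le_rfl

/-! ### Sums of points of two hyperbolas -/

/-- The sum `m (cosh s, sinh s) + m' (cosh s', sinh s')` of two points of two hyperbolas. -/
noncomputable def hypSum (m m' : ℝ) (p : ℝ × ℝ) : ℝ × ℝ :=
  (m * Real.cosh p.1 + m' * Real.cosh p.2, m * Real.sinh p.1 + m' * Real.sinh p.2)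

/-- The derivative of `hypSum`. -/
noncomputable def fderivHypSum (m m' : ℝ) (p : ℝ × ℝ) : ℝ × ℝ →L[ℝ] ℝ × ℝ :=
  (Matrix.toLin (.finTwoProd ℝ) (.finTwoProd ℝ)
    !![m * Real.sinh p.1, m' * Real.sinh p.2;
      m * Real.cosh p.1, m' * Real.cosh p.2]).toContinuousLinearMap

theorem hasFDerivAt_hypSum (m m' : ℝ) (p : ℝ × ℝ) :
    HasFDerivAt (hypSum m m') (fderivHypSum m m' p) p := by
  unfold fderivHypSum
  rw [Matrix.toLin_finTwoProd_toContinuousLinearMap]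
  have h1 : HasFDerivAt (Prod.fst : ℝ × ℝ → ℝ) (ContinuousLinearMap.fst ℝ ℝ ℝ) p := hasFDerivAt_fst
  have h2 : HasFDerivAt (Prod.snd : ℝ × ℝ → ℝ) (ContinuousLinearMap.snd ℝ ℝ ℝ) p := hasFDerivAt_snd
  have := ((((Real.hasDerivAt_cosh p.1).comp_hasFDerivAt p h1).const_mul m).add
    (((Real.hasDerivAt_cosh p.2).comp_hasFDerivAt p h2).const_mul m')).prodMk
    ((((Real.hasDerivAt_sinh p.1).comp_hasFDerivAt p h1).const_mul m).add
    (((Real.hasDerivAt_sinh p.2).comp_hasFDerivAt p h2).const_mul m'))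
  convert! this using 2 <;> simp [smul_smul]

theorem abs_det_fderivHypSum {m m' : ℝ} (hm : 0 < m) (hm' : 0 < m') (p : ℝ × ℝ) :
    |(fderivHypSum m m' p).det| = m * m' * |Real.sinh (p.1 - p.2)| := by
  have : (fderivHypSum m m' p).det = m * m' * Real.sinh (p.1 - p.2) := by
    unfold fderivHypSum
    simp only [LinearMap.det_toContinuousLinearMap, LinearMap.det_toLin, Matrix.det_fin_two_of,
      Real.sinh_sub]
    ring
  rw [this, abs_mul, abs_of_pos (mul_pos hm hm')]

/-- Two points on each of two hyperbolas have different sums, on each side of the diagonal. -/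
theorem hypSum_inj_aux {m m' : ℝ} (hm : 0 < m) (hm' : 0 < m') {a b c d : ℝ}
    (h : hypSum m m' (a, b) = hypSum m m' (c, d)) (hs : 0 < (a - b) * (c - d)) :
    (a, b) = (c, d) := by
  simp only [hypSum, Prod.mk.injEq] at h
  obtain ⟨h1, h2⟩ := h
  have e1 : m * Real.exp a + m' * Real.exp b = m * Real.exp c + m' * Real.exp d := by
    simp only [← Real.cosh_add_sinh]; linarith
  have e2 : m * Real.exp (-a) + m' * Real.exp (-b) = m * Real.exp (-c) + m' * Real.exp (-d) := by
    simp only [← Real.cosh_sub_sinh]; linarith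
  rw [Real.exp_neg, Real.exp_neg, Real.exp_neg, Real.exp_neg] at e2
  -- In the null coordinates `cosh ± sinh` the hyperbolas become `{(x, 1/x)}`. Comparing the two
  -- equations yields `exp c = exp a` or `a + c = b + d`.
  have e3 : (Real.exp c - Real.exp a)
      * (Real.exp b * Real.exp d - Real.exp a * Real.exp c) = 0 := by
    have h4 : m * (Real.exp c - Real.exp a) = m' * (Real.exp b - Real.exp d) := by linarith
    have h5 : m * (Real.exp c - Real.exp a) * (Real.exp b * Real.exp d)
        = m' * (Real.exp b - Real.exp d) * (Real.exp a * Real.exp c) := by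
      field_simp at e2
      nlinarith [e2]
    have h6 : m * ((Real.exp c - Real.exp a) *
        (Real.exp b * Real.exp d - Real.exp a * Real.exp c)) = 0 := by
      rw [← h4] at h5; linear_combination h5
    exact (mul_eq_zero.1 h6).resolve_left hm.ne'
  -- The alternative `a + c = b + d` says `a - b = -(c - d)`, which the sign condition excludes.
  have hne : Real.exp b * Real.exp d - Real.exp a * Real.exp c ≠ 0 := by
    rw [← Real.exp_add, ← Real.exp_add, sub_ne_zero]
    intro h
    have := Real.exp_injective h
    nlinarith [sq_nonneg (a - b), sq_nonneg (c - d), this]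
  have hac : c = a := Real.exp_injective (sub_eq_zero.1 ((mul_eq_zero.1 e3).resolve_right hne))
  subst hac
  have : b = d := Real.exp_injective (mul_left_cancel₀ hm'.ne' (by linarith))
  rw [this]

/-- The map is injective on each side of the diagonal, so it is at most two-to-one there, whence the
factor 2. On the diagonal the Jacobian vanishes. -/
theorem lintegral_hypSum_le {m m' : ℝ} (hm : 0 < m) (hm' : 0 < m') (h : ℝ × ℝ → ℝ≥0∞) :
    ∫⁻ p, ENNReal.ofReal (m * m' * |Real.sinh (p.1 - p.2)|) * h (hypSum m m' p)
      ≤ 2 * ∫⁻ v, h v := by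
  have key : ∀ s : Set (ℝ × ℝ), MeasurableSet s → Set.InjOn (hypSum m m') s →
      ∫⁻ p in s, ENNReal.ofReal (m * m' * |Real.sinh (p.1 - p.2)|) * h (hypSum m m' p)
        ≤ ∫⁻ v, h v := by
    intro s hs hinj
    have := lintegral_image_eq_lintegral_abs_det_fderiv_mul volume hs
      (fun p _ => (hasFDerivAt_hypSum m m' p).hasFDerivWithinAt) hinj h
    simp only [abs_det_fderivHypSum hm hm'] at this
    rw [← this]
    exact setLIntegral_le_lintegral _ _
  set A : Set (ℝ × ℝ) := {p | p.2 < p.1}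
  set B : Set (ℝ × ℝ) := {p | p.1 < p.2}
  set D : Set (ℝ × ℝ) := {p | p.1 = p.2}
  have hA : MeasurableSet A := measurableSet_lt measurable_snd measurable_fst
  have hB : MeasurableSet B := measurableSet_lt measurable_fst measurable_snd
  have hD : MeasurableSet D := measurableSet_eq_fun measurable_fst measurable_snd
  have huniv : (Set.univ : Set (ℝ × ℝ)) = A ∪ (B ∪ D) := by
    ext p
    simp only [Set.mem_univ, Set.mem_union, true_iff, A, B, D, Set.mem_ofPred_eq]
    rcases lt_trichotomy p.1 p.2 with h | h | h <;> tauto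
  have hD0 : ∫⁻ p in D, ENNReal.ofReal (m * m' * |Real.sinh (p.1 - p.2)|) * h (hypSum m m' p)
      = 0 := by
    rw [setLIntegral_congr_fun (g := fun _ => 0) hD]
    · simp
    · intro p hp
      have : p.1 = p.2 := hp
      simp [this]
  have hA' := key A hA (by
    rintro ⟨a, b⟩ h1 ⟨c, d⟩ h2 h
    have h1 : b < a := h1
    have h2 : d < c := h2
    exact hypSum_inj_aux hm hm' h (mul_pos (by linarith) (by linarith)))
  have hB' := key B hB (by
    rintro ⟨a, b⟩ h1 ⟨c, d⟩ h2 h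
    have h1 : a < b := h1
    have h2 : c < d := h2
    exact hypSum_inj_aux hm hm' h (mul_pos_of_neg_of_neg (by linarith) (by linarith)))
  rw [← setLIntegral_univ, huniv]
  refine (lintegral_union_le _ _ _).trans ?_
  rw [two_mul]
  refine add_le_add hA' ((lintegral_union_le _ _ _).trans ?_)
  rw [hD0, add_zero]
  exact hB'

/-! ### A weighted convolution inequality on the line -/

theorem lintegral_comp_mul_left_real {a : ℝ} (ha : a ≠ 0) (f : ℝ → ℝ≥0∞) :
    ∫⁻ x, f (a * x) = ENNReal.ofReal |a⁻¹| * ∫⁻ x, f x := by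
  rw [← (Homeomorph.mulLeft₀ a ha).measurableEmbedding.lintegral_map (f := f) (g := (a * ·)),
    Real.map_volume_mul_left ha, lintegral_smul_measure, smul_eq_mul]

/-- The weight `|x|^{-1/2}`. -/
noncomputable def invSqrtAbs (x : ℝ) : ℝ≥0∞ := ENNReal.ofReal (|x| ^ (-(1 / 2) : ℝ))

@[fun_prop]
theorem measurable_invSqrtAbs : Measurable invSqrtAbs := by
  unfold invSqrtAbs; fun_prop

/-- The constant of `lintegral_invSqrtAbs_conv_le`. -/
noncomputable def convConst : ℝ≥0∞ :=
  ∫⁻ t : ℝ, ENNReal.ofReal (|t| ^ (-(3 / 4) : ℝ) * |1 + t| ^ (-(1 / 2) : ℝ))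

theorem locallyIntegrable_abs_rpow {α : ℝ} (hα : α < 1) :
    LocallyIntegrable (fun x : ℝ => |x| ^ (-α)) := by
  apply locallyIntegrable_of_norm_le_rpow (C := 1) (α := α) (by simp) (by simpa using hα)
  · refine Filter.Eventually.of_forall fun x => ?_
    rw [one_mul, Real.norm_eq_abs, Real.norm_eq_abs, abs_of_nonneg (by positivity)]
  · exact (by fun_prop : Measurable fun x : ℝ => |x| ^ (-α)).aestronglyMeasurable

theorem abs_rpow_neg_le_of_le {x c : ℝ} {α : ℝ} (hc : 0 < c) (hα : 0 ≤ α) (h : c ≤ |x|) :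
    |x| ^ (-α) ≤ c ^ (-α) :=
  Real.rpow_le_rpow_of_nonpos hc h (by linarith)

/-- The singularities at `0` and `-1` have orders `3/4` and `1/2`, below 1, and the decay at
infinity has order `5/4`, above 1. -/
theorem convConst_ne_top : convConst ≠ ⊤ := by
  have i1 : IntegrableOn (fun t : ℝ => |t| ^ (-(3 / 4) : ℝ)) (Set.Icc (-2) 2) :=
    (locallyIntegrable_abs_rpow (by norm_num)).integrableOn_isCompact isCompact_Icc
  have i2 : IntegrableOn (fun t : ℝ => |1 + t| ^ (-(1 / 2) : ℝ)) (Set.Icc (-2) 2) := by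
    have h := (locallyIntegrable_abs_rpow (α := 1 / 2) (by norm_num)).integrableOn_isCompact
      (isCompact_Icc (a := (-1 : ℝ)) (b := 3))
    have := (measurePreserving_add_left volume (1 : ℝ)).integrableOn_comp_preimage
      (measurableEmbedding_addLeft 1) (f := fun x : ℝ => |x| ^ (-(1 / 2) : ℝ)) (s := Set.Icc (-1) 3)
    have h' := this.2 h
    have e : (fun x : ℝ => (1 : ℝ) + x) ⁻¹' Set.Icc (-1) 3 = Set.Icc (-2) 2 := by
      ext x; simp only [Set.mem_preimage, Set.mem_Icc]; constructor <;> rintro ⟨_, _⟩ <;>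
        constructor <;> linarith
    rw [e] at h'
    exact h'
  have i3 : Integrable (fun t : ℝ => (1 + ‖t‖) ^ (-(5 / 4) : ℝ)) :=
    integrable_one_add_norm (by simp; norm_num)
  have hbd : ∀ r : ℝ, 0 ≤ r → r ≤ 1 → ((1 / 2 : ℝ)) ^ (-r) ≤ 2 := by
    intro r h0 h1
    rw [one_div, Real.inv_rpow (by norm_num), Real.rpow_neg (by norm_num), inv_inv]
    calc (2 : ℝ) ^ r ≤ 2 ^ (1 : ℝ) := Real.rpow_le_rpow_of_exponent_le (by norm_num) h1
      _ = 2 := by norm_num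
  have main : Integrable (fun t : ℝ => |t| ^ (-(3 / 4) : ℝ) * |1 + t| ^ (-(1 / 2) : ℝ)) := by
    -- On `[-2, 2]` one of `|t|`, `|1 + t|` is at least `1/2`, so one factor is at most 2. Outside,
    -- both are at least `(1 + |t|) / 4`, and `4^(5/4) ≤ 8`.
    refine Integrable.mono' (g := fun t => (Set.Icc (-2 : ℝ) 2).indicator
      (fun t => 2 * |t| ^ (-(3 / 4) : ℝ) + 2 * |1 + t| ^ (-(1 / 2) : ℝ)) t
        + 8 * (1 + ‖t‖) ^ (-(5 / 4) : ℝ)) ?_ (by fun_prop) (Filter.Eventually.of_forall ?_)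
    · refine Integrable.add ?_ (i3.const_mul _)
      rw [integrable_indicator_iff measurableSet_Icc]
      exact (i1.const_mul 2).add (i2.const_mul 2)
    intro t
    rw [Real.norm_eq_abs, abs_of_nonneg (by positivity)]
    by_cases ht : t ∈ Set.Icc (-2 : ℝ) 2
    · rw [Set.indicator_of_mem ht]
      have h8 : 0 ≤ 8 * (1 + ‖t‖) ^ (-(5 / 4) : ℝ) := by positivity
      have hA : 0 ≤ |t| ^ (-(3 / 4) : ℝ) := by positivity
      have hB : 0 ≤ |1 + t| ^ (-(1 / 2) : ℝ) := by positivity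
      rcases le_total (1 / 2) |t| with h | h
      · have := (abs_rpow_neg_le_of_le (α := 3 / 4) (by norm_num) (by norm_num) h).trans
          (hbd (3 / 4) (by norm_num) (by norm_num))
        nlinarith
      · have h' : 1 / 2 ≤ |1 + t| := by
          have := abs_sub_abs_le_abs_sub (1 : ℝ) (-t)
          rw [abs_neg, abs_one, sub_neg_eq_add] at this
          linarith
        have := (abs_rpow_neg_le_of_le (α := 1 / 2) (by norm_num) (by norm_num) h').trans
          (hbd (1 / 2) (by norm_num) (by norm_num))
        nlinarith
    · rw [Set.indicator_of_notMem ht, zero_add, Real.norm_eq_abs]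
      have h2 : 2 < |t| := by
        by_contra hcon
        exact ht (Set.mem_Icc.2 (abs_le.1 (not_lt.1 hcon)))
      have h3 : (1 + |t|) / 4 ≤ |1 + t| := by
        have := abs_sub_abs_le_abs_sub t (-1 : ℝ)
        rw [abs_neg, abs_one, sub_neg_eq_add, add_comm t] at this
        linarith
      have h4 : (1 + |t|) / 4 ≤ |t| := by linarith
      have hp : 0 < (1 + |t|) / 4 := by linarith
      have g1 := abs_rpow_neg_le_of_le (α := 3 / 4) hp (by norm_num) h4
      have g2 := abs_rpow_neg_le_of_le (α := 1 / 2) hp (by norm_num) h3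
      have g3 := mul_le_mul g1 g2 (by positivity) (by positivity)
      refine g3.trans ?_
      rw [← Real.rpow_add hp, Real.div_rpow (by positivity) (by norm_num),
        show (-(3 / 4) + -(1 / 2) : ℝ) = -(5 / 4) by norm_num, Real.rpow_neg (x := 4) (by norm_num),
        div_inv_eq_mul, mul_comm]
      have : (4 : ℝ) ^ (5 / 4 : ℝ) ≤ 8 := by
        rw [show (4 : ℝ) ^ (5 / 4 : ℝ) = (2 ^ (2 : ℝ)) ^ (5 / 4 : ℝ) by norm_num, ← Real.rpow_mul
            (by norm_num)]
        calc (2 : ℝ) ^ (2 * (5 / 4) : ℝ) ≤ 2 ^ (3 : ℝ) :=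
              Real.rpow_le_rpow_of_exponent_le (by norm_num) (by norm_num)
          _ = 8 := by norm_num
      gcongr
  exact (hasFiniteIntegral_iff_ofReal (Filter.Eventually.of_forall fun t => by positivity)).1
    main.2 |>.ne

/-- A weighted convolution inequality in which the exponents `4`, `4`, `2` are critical. -/
theorem lintegral_invSqrtAbs_conv_le {f g h : ℝ → ℝ≥0∞} (hf : Measurable f) (hg : Measurable g)
    (hh : Measurable h) :
    ∫⁻ ξ, ∫⁻ η, f ξ ^ (1 / 4 : ℝ) * g η ^ (1 / 4 : ℝ) * h (ξ + η) ^ (1 / 2 : ℝ)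
        * (invSqrtAbs ξ * invSqrtAbs η)
      ≤ convConst * ((∫⁻ x, f x) ^ (1 / 4 : ℝ) * (∫⁻ x, g x) ^ (1 / 4 : ℝ)
          * (∫⁻ x, h x) ^ (1 / 2 : ℝ)) := by
  have hae : ∀ᵐ ξ : ℝ, ξ ≠ 0 := by simp [ae_iff]
  -- Substituting `η = t ξ`, the factor `|ξ|` from `dη` cancels the two weights up to `|t|^(-1/2)`.
  -- This is the scale invariance of the inequality.
  have step1 : ∀ᵐ ξ : ℝ, ∫⁻ η, f ξ ^ (1 / 4 : ℝ) * g η ^ (1 / 4 : ℝ) * h (ξ + η) ^ (1 / 2 : ℝ)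
        * (invSqrtAbs ξ * invSqrtAbs η)
      = ∫⁻ t, invSqrtAbs t * (f ξ ^ (1 / 4 : ℝ) * g (t * ξ) ^ (1 / 4 : ℝ)
          * h ((1 + t) * ξ) ^ (1 / 2 : ℝ)) := by
    filter_upwards [hae] with ξ hξ
    have := lintegral_comp_mul_left_real hξ (fun η => f ξ ^ (1 / 4 : ℝ) * g η ^ (1 / 4 : ℝ)
      * h (ξ + η) ^ (1 / 2 : ℝ) * (invSqrtAbs ξ * invSqrtAbs η))
    have h2 : ENNReal.ofReal |ξ| * ENNReal.ofReal |ξ⁻¹| = 1 := by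
      rw [← ENNReal.ofReal_mul (abs_nonneg _), ← abs_mul, mul_inv_cancel₀ hξ]; simp
    calc _ = ENNReal.ofReal |ξ| * (ENNReal.ofReal |ξ⁻¹| * ∫⁻ η, f ξ ^ (1 / 4 : ℝ)
          * g η ^ (1 / 4 : ℝ) * h (ξ + η) ^ (1 / 2 : ℝ) * (invSqrtAbs ξ * invSqrtAbs η)) := by
          rw [← mul_assoc, h2, one_mul]
      _ = _ := by
          rw [← this, ← lintegral_const_mul' _ _ ENNReal.ofReal_ne_top]
          congr 1; ext t
          have e : ENNReal.ofReal |ξ| * (invSqrtAbs ξ * invSqrtAbs (ξ * t)) = invSqrtAbs t := by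
            unfold invSqrtAbs
            rw [← ENNReal.ofReal_mul (by positivity), ← ENNReal.ofReal_mul (by positivity), abs_mul,
              Real.mul_rpow (by positivity) (by positivity)]
            congr 1
            have hx : 0 < |ξ| := abs_pos.2 hξ
            have : |ξ| ^ (-(1 / 2) : ℝ) * |ξ| ^ (-(1 / 2) : ℝ) = |ξ|⁻¹ := by
              rw [← Real.rpow_add hx, ← Real.rpow_neg_one]; norm_num
            calc _ = |ξ| * (|ξ| ^ (-(1 / 2) : ℝ) * |ξ| ^ (-(1 / 2) : ℝ))
                  * |t| ^ (-(1 / 2) : ℝ) := by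
                  ring
              _ = _ := by rw [this, mul_inv_cancel₀ hx.ne', one_mul]
          rw [show ξ + ξ * t = (1 + t) * ξ by ring, ← e, mul_comm t ξ]
          ring
  rw [lintegral_congr_ae step1, lintegral_lintegral_swap (by fun_prop)]
  have hae' : ∀ᵐ t : ℝ, t ≠ 0 ∧ 1 + t ≠ 0 := by
    refine (hae.and ?_)
    have : ∀ᵐ t : ℝ, t ≠ -1 := by simp [ae_iff]
    filter_upwards [this] with t ht h
    exact ht (by linarith)
  -- Hölder in `ξ` with exponents 4, 4, 2, done as Cauchy–Schwarz twice. Rescaling the integrals of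
  -- `g` and `h` yields `|t|^(-1/4)` and `|1 + t|^(-1/2)`.
  have holder : ∀ᵐ t : ℝ, ∫⁻ ξ, invSqrtAbs t * (f ξ ^ (1 / 4 : ℝ) * g (t * ξ) ^ (1 / 4 : ℝ)
          * h ((1 + t) * ξ) ^ (1 / 2 : ℝ))
      ≤ ENNReal.ofReal (|t| ^ (-(3 / 4) : ℝ) * |1 + t| ^ (-(1 / 2) : ℝ)) *
        ((∫⁻ x, f x) ^ (1 / 4 : ℝ) * (∫⁻ x, g x) ^ (1 / 4 : ℝ) * (∫⁻ x, h x) ^ (1 / 2 : ℝ)) := by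
    filter_upwards [hae'] with t ⟨ht, ht'⟩
    rw [lintegral_const_mul _ (by fun_prop)]
    have a1 : ∫⁻ ξ, f ξ ^ (1 / 4 : ℝ) * g (t * ξ) ^ (1 / 4 : ℝ) * h ((1 + t) * ξ) ^ (1 / 2 : ℝ)
        ≤ (∫⁻ ξ, f ξ ^ (1 / 2 : ℝ) * g (t * ξ) ^ (1 / 2 : ℝ)) ^ (1 / 2 : ℝ)
          * (∫⁻ ξ, h ((1 + t) * ξ)) ^ (1 / 2 : ℝ) := by
      refine le_trans (le_of_eq ?_) (ENNReal.lintegral_mul_norm_pow_le (by fun_prop) (by fun_prop)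
        (by norm_num) (by norm_num) (by norm_num))
      congr 1; ext ξ
      rw [ENNReal.mul_rpow_of_nonneg _ _ (by norm_num), ← ENNReal.rpow_mul, ← ENNReal.rpow_mul]
      norm_num
    have a2 : ∫⁻ ξ, f ξ ^ (1 / 2 : ℝ) * g (t * ξ) ^ (1 / 2 : ℝ)
        ≤ (∫⁻ ξ, f ξ) ^ (1 / 2 : ℝ) * (∫⁻ ξ, g (t * ξ)) ^ (1 / 2 : ℝ) :=
      ENNReal.lintegral_mul_norm_pow_le (by fun_prop) (by fun_prop)
        (by norm_num) (by norm_num) (by norm_num)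
    rw [lintegral_comp_mul_left_real ht g] at a2
    rw [lintegral_comp_mul_left_real ht' h] at a1
    have a3 := a1.trans (mul_le_mul_left (ENNReal.rpow_le_rpow a2 (by norm_num : (0 : ℝ) ≤ 1 / 2))
        _)
    refine (mul_le_mul_right a3 _).trans (le_of_eq ?_)
    have hr : ∀ x r : ℝ, x ≠ 0 → ENNReal.ofReal |x⁻¹| ^ r = ENNReal.ofReal (|x| ^ (-r)) := by
      intro x r hx
      rw [ENNReal.ofReal_rpow_of_pos (by positivity), abs_inv, Real.inv_rpow (by positivity),
        Real.rpow_neg (by positivity)]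
    simp only [ENNReal.mul_rpow_of_nonneg _ _ (by norm_num : (0 : ℝ) ≤ 1 / 2), ← ENNReal.rpow_mul]
    norm_num only
    rw [hr t _ ht, hr _ _ ht', ENNReal.ofReal_mul (by positivity)]
    have e4 : invSqrtAbs t * ENNReal.ofReal (|t| ^ (-(1 / 4) : ℝ))
        = ENNReal.ofReal (|t| ^ (-(3 / 4) : ℝ)) := by
      unfold invSqrtAbs
      rw [← ENNReal.ofReal_mul (by positivity), ← Real.rpow_add (abs_pos.2 ht)]
      norm_num
    rw [← e4]
    ring_nf
  refine (lintegral_mono_ae holder).trans (le_of_eq ?_)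
  rw [lintegral_mul_const _ (by fun_prop)]
  rfl

theorem lintegral_invSqrtAbs_sub_conv_le {f g h : ℝ → ℝ≥0∞} (hf : Measurable f)
    (hg : Measurable g) (hh : Measurable h) (a b : ℝ) :
    ∫⁻ ξ, ∫⁻ η, f ξ ^ (1 / 4 : ℝ) * g η ^ (1 / 4 : ℝ) * h (ξ + η) ^ (1 / 2 : ℝ)
        * (invSqrtAbs (ξ - a) * invSqrtAbs (η - b))
      ≤ convConst * ((∫⁻ x, f x) ^ (1 / 4 : ℝ) * (∫⁻ x, g x) ^ (1 / 4 : ℝ)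
          * (∫⁻ x, h x) ^ (1 / 2 : ℝ)) := by
  have key := lintegral_invSqrtAbs_conv_le (f := fun x => f (x + a)) (g := fun x => g (x + b))
    (h := fun x => h (x + (a + b))) (by fun_prop) (by fun_prop) (by fun_prop)
  rw [lintegral_add_right_eq_self f a, lintegral_add_right_eq_self g b,
    lintegral_add_right_eq_self h (a + b)] at key
  refine le_trans (le_of_eq ?_) key
  rw [← lintegral_add_right_eq_self _ a]
  congr 1; ext ξ
  rw [← lintegral_add_right_eq_self _ b]
  congr 1; ext η
  simp only [add_sub_cancel_right]
  rw [show ξ + a + (η + b) = ξ + η + (a + b) by ring]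

/-- The weight `|ξ² - 1|^{-1/4}`. -/
noncomputable def hypWeight (ξ : ℝ) : ℝ≥0∞ := ENNReal.ofReal (|ξ ^ 2 - 1| ^ (-(1 / 4) : ℝ))

@[fun_prop]
theorem measurable_hypWeight : Measurable hypWeight := by
  unfold hypWeight; fun_prop

/-- Factor `ξ² - 1 = (ξ - 1)(ξ + 1)` and use `x y ≤ x² + y²`. It separates the two singular points,
so that each can be translated to the origin. -/
theorem hypWeight_le (ξ : ℝ) : hypWeight ξ ≤ invSqrtAbs (ξ - 1) + invSqrtAbs (ξ - (-1)) := by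
  unfold hypWeight invSqrtAbs
  rw [← ENNReal.ofReal_add (by positivity) (by positivity)]
  apply ENNReal.ofReal_le_ofReal
  rw [show ξ ^ 2 - 1 = (ξ - 1) * (ξ - (-1)) by ring, abs_mul,
    Real.mul_rpow (abs_nonneg _) (abs_nonneg _)]
  have h : ∀ x : ℝ, |x| ^ (-(1 / 2) : ℝ) = (|x| ^ (-(1 / 4) : ℝ)) ^ 2 := by
    intro x
    rw [← Real.rpow_natCast, ← Real.rpow_mul (abs_nonneg _)]; norm_num
  rw [h, h]
  nlinarith [sq_nonneg (|ξ - 1| ^ (-(1 / 4) : ℝ) - |ξ - (-1)| ^ (-(1 / 4) : ℝ)),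
    sq_nonneg (|ξ - 1| ^ (-(1 / 4) : ℝ) + |ξ - (-1)| ^ (-(1 / 4) : ℝ))]

/-- The factor 4 counts the choices of a singular point `±1` for each of `ξ` and `η`. -/
theorem lintegral_hypWeight_conv_le {f g h : ℝ → ℝ≥0∞} (hf : Measurable f)
    (hg : Measurable g) (hh : Measurable h) :
    ∫⁻ ξ, ∫⁻ η, f ξ ^ (1 / 4 : ℝ) * g η ^ (1 / 4 : ℝ) * h (ξ + η) ^ (1 / 2 : ℝ)
        * (hypWeight ξ * hypWeight η)
      ≤ 4 * convConst * ((∫⁻ x, f x) ^ (1 / 4 : ℝ) * (∫⁻ x, g x) ^ (1 / 4 : ℝ)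
          * (∫⁻ x, h x) ^ (1 / 2 : ℝ)) := by
  set k : ℝ → ℝ → ℝ≥0∞ := fun ξ η =>
    f ξ ^ (1 / 4 : ℝ) * g η ^ (1 / 4 : ℝ) * h (ξ + η) ^ (1 / 2 : ℝ) with hk
  set J : ℝ → ℝ → ℝ≥0∞ := fun a b =>
    ∫⁻ ξ, ∫⁻ η, k ξ η * (invSqrtAbs (ξ - a) * invSqrtAbs (η - b)) with hJ
  have hJle : ∀ a b, J a b ≤ _ := fun a b => lintegral_invSqrtAbs_sub_conv_le hf hg hh a b
  have hle : ∫⁻ ξ, ∫⁻ η, k ξ η * (hypWeight ξ * hypWeight η)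
      ≤ J 1 1 + J 1 (-1) + (J (-1) 1 + J (-1) (-1)) := by
    rw [hJ]
    simp only
    rw [← lintegral_add_left (by fun_prop), ← lintegral_add_left (by fun_prop),
      ← lintegral_add_left (by fun_prop)]
    refine lintegral_mono fun ξ => ?_
    rw [← lintegral_add_left (by fun_prop), ← lintegral_add_left (by fun_prop),
      ← lintegral_add_left (by fun_prop)]
    refine lintegral_mono fun η => ?_
    refine (mul_le_mul_right (mul_le_mul' (hypWeight_le ξ) (hypWeight_le η)) _).trans
      (le_of_eq ?_)
    ring
  refine hle.trans ((add_le_add (add_le_add (hJle _ _) (hJle _ _))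
    (add_le_add (hJle _ _) (hJle _ _))).trans (le_of_eq ?_))
  ring

/-! ### Near and far pairs on two fixed slices -/

theorem lintegral_edist_lt_rpow_le {u : ℝ → ℝ≥0∞} (hu : Measurable u) {p : ℝ} (hp : 1 < p) (s : ℝ)
    (r : ℝ≥0∞) :
    ∫⁻ t in {t | edist s t < r}, u t ^ (1 / p) ≤ (∫⁻ t, u t) ^ (1 / p) * (2 * r) ^ (1 - 1 / p) := by
  have h0 : 0 ≤ 1 / p := by positivity
  have h1 : 1 / p ≤ 1 := by rw [div_le_one (by linarith)]; exact hp.le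
  have := ENNReal.lintegral_mul_norm_pow_le (μ := volume.restrict {t | edist s t < r})
    (f := u) (g := fun _ => 1) (by fun_prop) (by fun_prop) h0 (sub_nonneg.2 h1) (by ring)
  simp only [ENNReal.one_rpow, mul_one, lintegral_one, Measure.restrict_apply_univ] at this
  refine this.trans (mul_le_mul' (ENNReal.rpow_le_rpow (setLIntegral_le_lintegral _ _) h0)
    (ENNReal.rpow_le_rpow ?_ (sub_nonneg.2 h1)))
  have e : {t | edist s t < r} = Metric.eball s r := by
    ext t; simp [edist_comm]
  rw [e, Real.volume_eball]

/-- With `β' = ∫ v`, Hölder on the interval of radius `κ β' u(s)` bounds the inner integral by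
`u^(1/p) β'^(1/p) (2 κ β' u)^(1 - 1/p)`. The radius is the one for which this is linear in both
`u(s)` and `β'`. -/
theorem lintegral_near_le {u v : ℝ → ℝ≥0∞} (hu : Measurable u) (hv : Measurable v) {p : ℝ}
    (hp : 1 < p) (κ : ℝ≥0∞) :
    ∫⁻ s, ∫⁻ t in {t | edist s t < κ * (∫⁻ x, v x) * u s}, u s ^ (1 / p) * v t ^ (1 / p)
      ≤ (2 * κ) ^ (1 - 1 / p) * ((∫⁻ x, u x) * ∫⁻ x, v x) := by
  have h0 : 0 ≤ 1 / p := by positivity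
  have h1 : 0 ≤ 1 - 1 / p := by rw [sub_nonneg, div_le_one (by linarith)]; exact hp.le
  have e : ∀ x : ℝ≥0∞, x ^ (1 / p) * x ^ (1 - 1 / p) = x := by
    intro x
    rw [← ENNReal.rpow_add_of_nonneg _ _ h0 h1]; simp
  calc _ ≤ ∫⁻ s, (2 * κ) ^ (1 - 1 / p) * (∫⁻ x, v x) * u s := by
        refine lintegral_mono fun s => ?_
        rw [lintegral_const_mul _ (by fun_prop)]
        refine (mul_le_mul_right (lintegral_edist_lt_rpow_le hv hp s _) _).trans (le_of_eq ?_)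
        rw [show 2 * (κ * (∫⁻ x, v x) * u s) = (2 * κ) * ((∫⁻ x, v x) * u s) by ring,
          ENNReal.mul_rpow_of_nonneg (2 * κ) _ h1,
          ENNReal.mul_rpow_of_nonneg (∫⁻ x, v x) _ h1]
        calc _ = (2 * κ) ^ (1 - 1 / p) * ((∫⁻ x, v x) ^ (1 / p) * (∫⁻ x, v x) ^ (1 - 1 / p))
              * (u s ^ (1 / p) * u s ^ (1 - 1 / p)) := by ring
          _ = _ := by rw [e, e]
    _ = _ := by
        rw [lintegral_const_mul _ hu]; ring

theorem lintegral_le_edist_rpow_neg {b : ℝ} (hb : 1 < b) (s : ℝ) {r : ℝ≥0∞} (hr : r ≠ 0)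
    (hr' : r ≠ ⊤) :
    ∫⁻ t in {t | r ≤ edist s t}, edist s t ^ (-b) ≤ ENNReal.ofReal (2 / (b - 1)) * r ^ (1 - b) := by
  lift r to ℝ≥0 using hr'
  have hr0 : 0 < (r : ℝ) := by
    have : r ≠ 0 := by exact_mod_cast hr
    positivity
  have base : ∫⁻ t in Set.Ici (r : ℝ), ENNReal.ofReal |t| ^ (-b)
      = ENNReal.ofReal (1 / (b - 1)) * (r : ℝ≥0∞) ^ (1 - b) := by
    rw [← restrict_Ioi_eq_restrict_Ici]
    have e1 : ∫⁻ t in Set.Ioi (r : ℝ), ENNReal.ofReal |t| ^ (-b)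
        = ∫⁻ t in Set.Ioi (r : ℝ), ENNReal.ofReal (t ^ (-b)) := by
      refine setLIntegral_congr_fun measurableSet_Ioi fun t ht => ?_
      have ht' : 0 < t := hr0.trans ht
      rw [abs_of_pos ht', ENNReal.ofReal_rpow_of_pos ht']
    rw [e1, ← ofReal_integral_eq_lintegral_ofReal
      (integrableOn_Ioi_rpow_of_lt (by linarith) hr0), integral_Ioi_rpow_of_lt (by linarith) hr0]
    · rw [← ENNReal.ofReal_coe_nnreal, ENNReal.ofReal_rpow_of_pos hr0,
        ← ENNReal.ofReal_mul (by rw [one_div, inv_nonneg]; linarith)]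
      congr 1
      rw [show -b + 1 = -(b - 1) by ring, show 1 - b = -(b - 1) by ring, neg_div_neg_eq]
      ring
    · filter_upwards [self_mem_ae_restrict measurableSet_Ioi] with t ht
      exact Real.rpow_nonneg (hr0.trans ht).le _
  have hm : MeasurableSet {t : ℝ | (r : ℝ≥0∞) ≤ edist s t} :=
    measurableSet_le measurable_const (by fun_prop)
  rw [← lintegral_indicator hm, ← lintegral_sub_left_eq_self _ s]
  have hsub : ∀ t : ℝ, {t : ℝ | (r : ℝ≥0∞) ≤ edist s t}.indicator (fun t => edist s t ^ (-b))
      (s - t)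
      ≤ (Set.Ici (r : ℝ)).indicator (fun t => ENNReal.ofReal |t| ^ (-b)) t
        + (Set.Ici (r : ℝ)).indicator (fun t => ENNReal.ofReal |t| ^ (-b)) (-t) := by
    intro t
    have hed : edist s (s - t) = ENNReal.ofReal |t| := by
      rw [edist_dist, Real.dist_eq, sub_sub_cancel]
    by_cases h : s - t ∈ {t : ℝ | (r : ℝ≥0∞) ≤ edist s t}
    · rw [Set.indicator_of_mem h, hed]
      have h' : (r : ℝ) ≤ |t| := by
        have : (r : ℝ≥0∞) ≤ edist s (s - t) := h
        rw [hed, ← ENNReal.ofReal_coe_nnreal] at this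
        exact (ENNReal.ofReal_le_ofReal_iff (abs_nonneg _)).1 this
      rcases le_abs.1 h' with h1 | h1
      · rw [Set.indicator_of_mem (show t ∈ Set.Ici (r : ℝ) from h1)]
        exact le_self_add
      · rw [Set.indicator_of_mem (show -t ∈ Set.Ici (r : ℝ) from h1), abs_neg]
        exact le_add_self
    · rw [Set.indicator_of_notMem h]; exact zero_le
  refine (lintegral_mono hsub).trans ?_
  have hmeas : Measurable ((Set.Ici (r : ℝ)).indicator
      (fun t => ENNReal.ofReal |t| ^ (-b))) :=
    (by fun_prop : Measurable fun t : ℝ => ENNReal.ofReal |t| ^ (-b)).indicator measurableSet_Ici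
  rw [lintegral_add_left hmeas,
    lintegral_neg_eq_self ((Set.Ici (r : ℝ)).indicator (fun t => ENNReal.ofReal |t| ^ (-b))),
    lintegral_indicator measurableSet_Ici, base, ← two_mul, ← mul_assoc]
  apply le_of_eq
  congr 1
  rw [show (2 : ℝ≥0∞) = ENNReal.ofReal 2 by simp, ← ENNReal.ofReal_mul (by norm_num)]
  congr 1; ring

/-- The constant of `lintegral_half_far_le`. -/
noncomputable def farConst (a : ℝ) : ℝ≥0∞ := ENNReal.ofReal (2 / (1 / (1 - a) - 1)) ^ (1 - a)

theorem farConst_ne_top {a : ℝ} (ha : a < 1) : farConst a ≠ ⊤ :=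
  ENNReal.rpow_ne_top_of_nonneg (by linarith) ENNReal.ofReal_ne_top

/-- Hölder with exponents `1/a` and `1/(1 - a)`. The power of `v` becomes `v^(1 + 1/(2a))`, whose
excess over `v` is absorbed by the upper bound `c`. The kernel becomes `|s - t|^(-1/(1 - a))`,
integrable away from the diagonal because `a > 0`. -/
theorem lintegral_half_far_inner_le {v : ℝ → ℝ≥0∞} (hv : Measurable v) {a : ℝ} (ha : 0 < a)
    (ha1 : a < 1) (s : ℝ) {r c : ℝ≥0∞} (hr : r ≠ 0) (hr' : r ≠ ⊤) :
    ∫⁻ t in {t | r ≤ edist s t ∧ v t ≤ c}, v t ^ (1 / 2 + a) * (edist s t)⁻¹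
      ≤ farConst a * ((∫⁻ x, v x) ^ a * c ^ (1 / 2 : ℝ) * r ^ (-a)) := by
  set S := {t | r ≤ edist s t ∧ v t ≤ c}
  have h1a : 0 < 1 - a := by linarith
  have hold := ENNReal.lintegral_mul_norm_pow_le (μ := volume.restrict S)
    (f := fun t => v t ^ (1 + 1 / (2 * a))) (g := fun t => edist s t ^ (-(1 / (1 - a))))
    (by fun_prop) (by fun_prop) ha.le h1a.le (by ring)
  have e : ∫⁻ t in S, v t ^ (1 / 2 + a) * (edist s t)⁻¹
      = ∫⁻ t in S, (v t ^ (1 + 1 / (2 * a))) ^ a * (edist s t ^ (-(1 / (1 - a)))) ^ (1 - a) := by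
    congr 1; ext t
    rw [← ENNReal.rpow_mul, ← ENNReal.rpow_mul, ← ENNReal.rpow_neg_one]
    congr 2
    · field_simp
      ring
    · field_simp
  rw [e]
  refine hold.trans ?_
  have b1 : ∫⁻ t in S, v t ^ (1 + 1 / (2 * a)) ≤ (∫⁻ x, v x) * c ^ (1 / (2 * a)) := by
    calc _ ≤ ∫⁻ t in S, v t * c ^ (1 / (2 * a)) := by
          refine setLIntegral_mono (by fun_prop) fun t ht => ?_
          rw [ENNReal.rpow_add_of_nonneg _ _ (by norm_num) (by positivity), ENNReal.rpow_one]
          exact mul_le_mul_right (ENNReal.rpow_le_rpow ht.2 (by positivity)) _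
      _ ≤ ∫⁻ t, v t * c ^ (1 / (2 * a)) := setLIntegral_le_lintegral _ _
      _ = _ := lintegral_mul_const _ hv
  have hb : 1 < 1 / (1 - a) := by rw [lt_div_iff₀ h1a]; linarith
  have b2 : ∫⁻ t in S, edist s t ^ (-(1 / (1 - a)))
      ≤ ENNReal.ofReal (2 / (1 / (1 - a) - 1)) * r ^ (1 - 1 / (1 - a)) :=
    (lintegral_mono_set (fun t ht => ht.1)).trans (lintegral_le_edist_rpow_neg hb s hr hr')
  refine (mul_le_mul' (ENNReal.rpow_le_rpow b1 ha.le) (ENNReal.rpow_le_rpow b2 h1a.le)).trans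
    (le_of_eq ?_)
  rw [ENNReal.mul_rpow_of_nonneg _ _ ha.le, ENNReal.mul_rpow_of_nonneg _ _ h1a.le,
    ← ENNReal.rpow_mul, ← ENNReal.rpow_mul, show 1 / (2 * a) * a = 1 / 2 by field_simp,
    show (1 - 1 / (1 - a)) * (1 - a) = -a by field_simp; ring]
  unfold farConst
  ring

/-- Write `β = ∫ u`, `β' = ∫ v`. With radius `r = κ β' u(s)` and bound `c = β' u(s) / β`, the powers
of `u(s)` from the inner estimate add up to exactly 1, leaving `κ^(-a) (β'/β)^(1/2) u(s)`, which
integrates to `κ^(-a) (β β')^(1/2)`. -/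
theorem lintegral_half_far_le {u v : ℝ → ℝ≥0∞} (hu : Measurable u) (hv : Measurable v) {a : ℝ}
    (ha : 0 < a) (ha1 : a < 1) {κ : ℝ≥0∞} (hκ : κ ≠ 0) (hκ' : κ ≠ ⊤) (hui : ∀ s, u s ≠ ⊤)
    (hu' : ∫⁻ x, u x ≠ ⊤) (hv' : ∫⁻ x, v x ≠ ⊤) :
    ∫⁻ s, ∫⁻ t in {t | κ * (∫⁻ x, v x) * u s ≤ edist s t ∧ (∫⁻ x, u x) * v t ≤ (∫⁻ x, v x) * u s},
        u s ^ (1 / 2 + a) * (v t ^ (1 / 2 + a) * (edist s t)⁻¹)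
      ≤ farConst a * κ ^ (-a) * ((∫⁻ x, u x) ^ (1 / 2 : ℝ) * (∫⁻ x, v x) ^ (1 / 2 : ℝ)) := by
  set β := ∫⁻ x, u x
  set β' := ∫⁻ x, v x
  have hpos : 0 < 1 / 2 + a := by positivity
  rcases eq_or_ne β' 0 with h0 | h0
  · have : ∀ᵐ t, v t = 0 := (lintegral_eq_zero_iff hv).1 h0
    refine (le_of_eq ?_).trans zero_le
    refine (lintegral_congr fun s => ?_).trans lintegral_zero
    rw [lintegral_eq_zero_iff (by fun_prop)]
    filter_upwards [ae_restrict_of_ae this] with t ht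
    simp only [ht, ENNReal.zero_rpow_of_pos hpos, zero_mul, mul_zero, Pi.zero_apply]
  rcases eq_or_ne β 0 with h1 | h1
  · have : ∀ᵐ t, u t = 0 := (lintegral_eq_zero_iff hu).1 h1
    refine (lintegral_mono_ae (g := fun _ => 0) ?_).trans (by simp)
    filter_upwards [this] with t ht
    simp only [ht, ENNReal.zero_rpow_of_pos hpos, zero_mul, lintegral_zero, le_refl]
  have key : ∀ s, ∫⁻ t in {t | κ * β' * u s ≤ edist s t ∧ β * v t ≤ β' * u s},
        u s ^ (1 / 2 + a) * (v t ^ (1 / 2 + a) * (edist s t)⁻¹)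
      ≤ farConst a * κ ^ (-a) * (β' ^ (1 / 2 : ℝ) * β ^ (-(1 / 2) : ℝ)) * u s := by
    intro s
    rcases eq_or_ne (u s) 0 with hs | hs
    · simp only [hs, ENNReal.zero_rpow_of_pos hpos, zero_mul, lintegral_zero, mul_zero, le_refl]
    rw [lintegral_const_mul _ (by fun_prop)]
    have hset : {t | κ * β' * u s ≤ edist s t ∧ β * v t ≤ β' * u s}
        = {t | κ * β' * u s ≤ edist s t ∧ v t ≤ β' * u s / β} := by
      ext t
      simp only [Set.mem_ofPred_eq, ENNReal.le_div_iff_mul_le (Or.inl h1) (Or.inl hu'), mul_comm]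
    rw [hset]
    have hm := mul_ne_zero (mul_ne_zero hκ h0) hs
    have hm' := ENNReal.mul_ne_top (ENNReal.mul_ne_top hκ' hv') (hui s)
    refine (mul_le_mul_right (lintegral_half_far_inner_le hv ha ha1 s hm hm') _).trans
      (le_of_eq ?_)
    rw [ENNReal.div_rpow_of_nonneg _ _ (by norm_num), ENNReal.mul_rpow_of_nonneg _ _ (by norm_num),
      ENNReal.mul_rpow_of_ne_top (ENNReal.mul_ne_top hκ' hv') (hui s),
      ENNReal.mul_rpow_of_ne_top hκ' hv', ENNReal.div_eq_inv_mul,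
      ← ENNReal.rpow_neg, ENNReal.rpow_add _ _ hs (hui s)]
    have c1 : β' ^ a * β' ^ (-a) = 1 := by
      rw [← ENNReal.rpow_add _ _ h0 hv']; simp
    have c2 : u s ^ a * u s ^ (-a) = 1 := by
      rw [← ENNReal.rpow_add _ _ hs (hui s)]; simp
    have c3 : u s ^ (1 / 2 : ℝ) * u s ^ (1 / 2 : ℝ) = u s := by
      rw [← ENNReal.rpow_add _ _ hs (hui s)]; norm_num
    calc _ = farConst a * κ ^ (-a) * (β' ^ (1 / 2 : ℝ) * β ^ (-(1 / 2) : ℝ))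
          * (β' ^ a * β' ^ (-a)) * (u s ^ a * u s ^ (-a))
          * (u s ^ (1 / 2 : ℝ) * u s ^ (1 / 2 : ℝ)) := by ring
      _ = _ := by rw [c1, c2, c3]; ring
  refine (lintegral_mono key).trans (le_of_eq ?_)
  rw [lintegral_const_mul _ hu]
  have c4 : β ^ (-(1 / 2) : ℝ) * β = β ^ (1 / 2 : ℝ) := by
    conv_lhs => rw [← ENNReal.rpow_one β, ← ENNReal.rpow_mul, ← ENNReal.rpow_add _ _ h1 hu']
    norm_num
  calc _ = farConst a * κ ^ (-a) * (β' ^ (1 / 2 : ℝ) * (β ^ (-(1 / 2) : ℝ) * β)) := by ring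
    _ = _ := by rw [c4]; ring

theorem setLIntegral_prodMk_left {S : Set (ℝ × ℝ)} (hS : MeasurableSet S) (f : ℝ × ℝ → ℝ≥0∞)
    (s : ℝ) : ∫⁻ t, S.indicator f (s, t) = ∫⁻ t in {t | (s, t) ∈ S}, f (s, t) := by
  rw [← lintegral_indicator (show MeasurableSet {t | (s, t) ∈ S} from measurable_prodMk_left hS)]
  rfl

/-- Every pair satisfies `β v(t) ≤ β' u(s)` or the reverse, where `β = ∫ u` and `β' = ∫ v`.
Exchanging the roles of `u` and `v` reduces the second case to the first, whence the factor 2. -/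
theorem lintegral_far_le {u v : ℝ → ℝ≥0∞} (hu : Measurable u) (hv : Measurable v) {a : ℝ}
    (ha : 0 < a) (ha1 : a < 1) {κ : ℝ≥0∞} (hκ : κ ≠ 0) (hκ' : κ ≠ ⊤) (hui : ∀ s, u s ≠ ⊤)
    (hvi : ∀ s, v s ≠ ⊤) (hu' : ∫⁻ x, u x ≠ ⊤) (hv' : ∫⁻ x, v x ≠ ⊤) :
    ∫⁻ s, ∫⁻ t in {t | κ * (∫⁻ x, v x) * u s ≤ edist s t ∧ κ * (∫⁻ x, u x) * v t ≤ edist s t},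
        u s ^ (1 / 2 + a) * (v t ^ (1 / 2 + a) * (edist s t)⁻¹)
      ≤ 2 * farConst a * κ ^ (-a) * ((∫⁻ x, u x) ^ (1 / 2 : ℝ) * (∫⁻ x, v x) ^ (1 / 2 : ℝ)) := by
  have A := lintegral_half_far_le hu hv ha ha1 hκ hκ' hui hu' hv'
  have B := lintegral_half_far_le hv hu ha ha1 hκ hκ' hvi hv' hu'
  set β := ∫⁻ x, u x
  set β' := ∫⁻ x, v x
  have hm1 : MeasurableSet {p : ℝ × ℝ | κ * β * v p.1 ≤ edist p.1 p.2} :=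
    measurableSet_le (by fun_prop) (by fun_prop)
  have hm2 : MeasurableSet {p : ℝ × ℝ | β' * u p.2 ≤ β * v p.1} :=
    measurableSet_le (by fun_prop) (by fun_prop)
  set S : Set (ℝ × ℝ) := {p | κ * β * v p.1 ≤ edist p.1 p.2 ∧ β' * u p.2 ≤ β * v p.1}
  have hS : MeasurableSet S := hm1.inter hm2
  have hsplit : ∀ s, ∫⁻ t in {t | κ * β' * u s ≤ edist s t ∧ κ * β * v t ≤ edist s t},
        u s ^ (1 / 2 + a) * (v t ^ (1 / 2 + a) * (edist s t)⁻¹)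
      ≤ (∫⁻ t in {t | κ * β' * u s ≤ edist s t ∧ β * v t ≤ β' * u s},
          u s ^ (1 / 2 + a) * (v t ^ (1 / 2 + a) * (edist s t)⁻¹))
        + ∫⁻ t, S.indicator (fun p => v p.1 ^ (1 / 2 + a) * (u p.2 ^ (1 / 2 + a)
          * (edist p.1 p.2)⁻¹)) (t, s) := by
    intro s
    refine (lintegral_mono_set (t := {t | κ * β' * u s ≤ edist s t ∧ β * v t ≤ β' * u s} ∪
      {t | (t, s) ∈ S}) ?_).trans ((lintegral_union_le _ _ _).trans (add_le_add le_rfl ?_))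
    · rintro t ⟨h1, h2⟩
      rcases le_total (β * v t) (β' * u s) with h | h
      · exact Or.inl ⟨h1, h⟩
      · exact Or.inr ⟨by rwa [edist_comm], h⟩
    · rw [← lintegral_indicator
        (show MeasurableSet {t | (t, s) ∈ S} from measurable_prodMk_right hS)]
      refine lintegral_mono fun t => ?_
      by_cases h : (t, s) ∈ S
      · rw [Set.indicator_of_mem (show t ∈ {t | (t, s) ∈ S} from h), Set.indicator_of_mem h,
          edist_comm s t]
        exact le_of_eq (by ring)
      · rw [Set.indicator_of_notMem (show t ∉ {t | (t, s) ∈ S} from h)]; exact zero_le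
  have hmS : Measurable (S.indicator (fun p => v p.1 ^ (1 / 2 + a) * (u p.2 ^ (1 / 2 + a)
          * (edist p.1 p.2)⁻¹))) :=
    Measurable.indicator (by fun_prop) hS
  have hmS' : Measurable fun p : ℝ × ℝ => S.indicator (fun p => v p.1 ^ (1 / 2 + a)
      * (u p.2 ^ (1 / 2 + a) * (edist p.1 p.2)⁻¹)) (p.2, p.1) := hmS.comp measurable_swap
  refine (lintegral_mono hsplit).trans ?_
  rw [lintegral_add_right _ hmS'.lintegral_prod_right']
  have hB : ∫⁻ s, ∫⁻ t, S.indicator (fun p => v p.1 ^ (1 / 2 + a) * (u p.2 ^ (1 / 2 + a)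
          * (edist p.1 p.2)⁻¹)) (t, s)
      ≤ farConst a * κ ^ (-a) * (β' ^ (1 / 2 : ℝ) * β ^ (1 / 2 : ℝ)) := by
    rw [lintegral_lintegral_swap hmS'.aemeasurable]
    exact le_trans (lintegral_mono fun t => (setLIntegral_prodMk_left hS _ t).le) B
  refine (add_le_add A hB).trans (le_of_eq ?_)
  ring

/-! ### Near and far pairs of points of the hyperboloid -/

/-- The parametrization `(ξ, s) ↦ (ξ, m cosh s, m sinh s)`, `m = √|ξ² - 1|`, of a piece of the
hyperboloid. -/
noncomputable def hypParam (ρ : ℝ × ℝ) : ℝ × ℝ × ℝ :=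
  (ρ.1, √|ρ.1 ^ 2 - 1| * Real.cosh ρ.2, √|ρ.1 ^ 2 - 1| * Real.sinh ρ.2)

@[fun_prop]
theorem measurable_hypParam : Measurable hypParam := by
  unfold hypParam; fun_prop

theorem lintegral_prod_prod_reorder {F : (ℝ × ℝ) × (ℝ × ℝ) → ℝ≥0∞} (hF : Measurable F) :
    ∫⁻ x, F x = ∫⁻ ξ, ∫⁻ η, ∫⁻ s, ∫⁻ t, F ((ξ, s), (η, t)) := by
  rw [Measure.volume_eq_prod, lintegral_prod _ hF.aemeasurable, Measure.volume_eq_prod ℝ ℝ,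
    lintegral_prod _ (by fun_prop)]
  refine lintegral_congr fun ξ => ?_
  have : ∀ s, ∫⁻ y, F ((ξ, s), y) ∂((volume : Measure ℝ).prod volume)
      = ∫⁻ η, ∫⁻ t, F ((ξ, s), (η, t)) := fun s => lintegral_prod _ (by fun_prop)
  simp_rw [this]
  rw [lintegral_lintegral_swap (by fun_prop)]

theorem lintegral_lintegral_reorder {F : ℝ × ℝ → ℝ≥0∞} (hF : Measurable F) :
    ∫⁻ x, F x = ∫⁻ ξ, ∫⁻ s, F (ξ, s) := by
  rw [Measure.volume_eq_prod, lintegral_prod _ hF.aemeasurable]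

/-- The pairs of points whose `s`-coordinates are far apart, relative to the density `u`. -/
def farSet (u : ℝ × ℝ → ℝ≥0∞) (κ : ℝ≥0∞) : Set ((ℝ × ℝ) × (ℝ × ℝ)) :=
  {x | κ * (∫⁻ s, u (x.2.1, s)) * u x.1 ≤ edist x.1.2 x.2.2 ∧
    κ * (∫⁻ s, u (x.1.1, s)) * u x.2 ≤ edist x.1.2 x.2.2}

theorem measurableSet_farSet {u : ℝ × ℝ → ℝ≥0∞} (hu : Measurable u) (κ : ℝ≥0∞) :
    MeasurableSet (farSet u κ) := by
  have h1 : MeasurableSet {x : (ℝ × ℝ) × (ℝ × ℝ) |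
      κ * (∫⁻ s, u (x.2.1, s)) * u x.1 ≤ edist x.1.2 x.2.2} :=
    measurableSet_le (by fun_prop) (by fun_prop)
  have h2 : MeasurableSet {x : (ℝ × ℝ) × (ℝ × ℝ) |
      κ * (∫⁻ s, u (x.1.1, s)) * u x.2 ≤ edist x.1.2 x.2.2} :=
    measurableSet_le (by fun_prop) (by fun_prop)
  exact h1.inter h2

/-- A pair fails to be far through one of two conditions, exchanged by swapping its points, whence
the factor 2. The slicewise bound is a product of slice masses, so integrating it over `ξ, η` gives
the square of the total mass. -/
theorem setLIntegral_compl_farSet_le {u : ℝ × ℝ → ℝ≥0∞} (hu : Measurable u) {p : ℝ} (hp : 1 < p)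
    (κ : ℝ≥0∞) :
    ∫⁻ x in (farSet u κ)ᶜ, u x.1 ^ (1 / p) * u x.2 ^ (1 / p)
      ≤ 2 * (2 * κ) ^ (1 - 1 / p) * (∫⁻ ρ, u ρ) ^ 2 := by
  have hβ : Measurable fun ξ => ∫⁻ s, u (ξ, s) := hu.lintegral_prod_right'
  set S₁ : Set ((ℝ × ℝ) × (ℝ × ℝ)) :=
    {x | edist x.1.2 x.2.2 < κ * (∫⁻ s, u (x.2.1, s)) * u x.1} with hS₁
  have hm₁ : MeasurableSet S₁ := measurableSet_lt (by fun_prop) (by fun_prop)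
  have key : ∫⁻ x in S₁, u x.1 ^ (1 / p) * u x.2 ^ (1 / p)
      ≤ (2 * κ) ^ (1 - 1 / p) * (∫⁻ ρ, u ρ) ^ 2 := by
    rw [← lintegral_indicator hm₁, lintegral_prod_prod_reorder
      (Measurable.indicator (by fun_prop) hm₁)]
    calc _ ≤ ∫⁻ ξ, ∫⁻ η, (2 * κ) ^ (1 - 1 / p) * ((∫⁻ s, u (ξ, s)) * ∫⁻ s, u (η, s)) := by
          refine lintegral_mono fun ξ => lintegral_mono fun η => ?_
          refine le_trans (lintegral_mono fun s => ?_) (lintegral_near_le (u := fun s => u (ξ, s))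
            (v := fun s => u (η, s)) (by fun_prop) (by fun_prop) hp κ)
          rw [← lintegral_indicator (measurableSet_lt (by fun_prop) measurable_const)]
          exact le_rfl
      _ = _ := by
          simp_rw [lintegral_const_mul _ (hβ.const_mul _), lintegral_const_mul _ hβ]
          rw [lintegral_const_mul _ (hβ.mul_const _), lintegral_mul_const _ hβ, sq,
            lintegral_lintegral_reorder hu]
  have hsub : (farSet u κ)ᶜ ⊆ S₁ ∪ Prod.swap ⁻¹' S₁ := by
    intro x hx
    have hx' : ¬ (κ * (∫⁻ s, u (x.2.1, s)) * u x.1 ≤ edist x.1.2 x.2.2 ∧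
      κ * (∫⁻ s, u (x.1.1, s)) * u x.2 ≤ edist x.1.2 x.2.2) := hx
    rw [not_and_or, not_le, not_le] at hx'
    rcases hx' with h | h
    · exact Or.inl h
    · refine Or.inr ?_
      show edist x.2.2 x.1.2 < κ * (∫⁻ s, u (x.1.1, s)) * u x.2
      rwa [edist_comm]
  have hswap : ∫⁻ x in Prod.swap ⁻¹' S₁, u x.1 ^ (1 / p) * u x.2 ^ (1 / p)
      = ∫⁻ x in S₁, u x.1 ^ (1 / p) * u x.2 ^ (1 / p) := by
    have hmp : MeasurePreserving (Prod.swap : (ℝ × ℝ) × (ℝ × ℝ) → (ℝ × ℝ) × (ℝ × ℝ)) :=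
      Measure.measurePreserving_swap
    rw [← hmp.setLIntegral_comp_preimage hm₁
      (by fun_prop : Measurable fun x : (ℝ × ℝ) × (ℝ × ℝ) => u x.1 ^ (1 / p) * u x.2 ^ (1 / p))]
    refine lintegral_congr fun x => ?_
    simp only [Prod.fst_swap, Prod.snd_swap]
    ring
  refine (lintegral_mono_set hsub).trans ((lintegral_union_le _ _ _).trans ?_)
  rw [hswap]
  refine (add_le_add key key).trans (le_of_eq ?_)
  ring

theorem ae_fst_ne_snd : ∀ᵐ p : ℝ × ℝ, p.1 ≠ p.2 := by
  have hm : MeasurableSet {p : ℝ × ℝ | p.1 ≠ p.2} :=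
    (measurableSet_eq_fun measurable_fst measurable_snd).compl
  rw [Measure.volume_eq_prod, Measure.ae_prod_iff_ae_ae hm]
  refine Filter.Eventually.of_forall fun s => ?_
  simp [ae_iff]

theorem hypWeight_mul_hypWeight {ξ η : ℝ} (hξ : ξ ^ 2 - 1 ≠ 0) (hη : η ^ 2 - 1 ≠ 0) :
    (ENNReal.ofReal (√|ξ ^ 2 - 1| * √|η ^ 2 - 1|))⁻¹ ^ (1 / 2 : ℝ) = hypWeight ξ * hypWeight η := by
  have h : ∀ x : ℝ, x ^ 2 - 1 ≠ 0 →
      (ENNReal.ofReal √|x ^ 2 - 1|)⁻¹ ^ (1 / 2 : ℝ) = hypWeight x := by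
    intro x hx
    have hx' := abs_pos.2 hx
    unfold hypWeight
    rw [← ENNReal.ofReal_inv_of_pos (Real.sqrt_pos.2 hx'), ENNReal.ofReal_rpow_of_pos
      (by positivity), Real.sqrt_eq_rpow, ← Real.rpow_neg (abs_nonneg _),
      ← Real.rpow_mul (abs_nonneg _)]
    norm_num
  have e1 : 0 < √|ξ ^ 2 - 1| := Real.sqrt_pos.2 (abs_pos.2 hξ)
  rw [ENNReal.ofReal_mul e1.le, ENNReal.mul_inv (Or.inl (by simpa using e1))
    (Or.inl ENNReal.ofReal_ne_top), ENNReal.mul_rpow_of_nonneg _ _ (by norm_num), h ξ hξ, h η hη]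

/-- Replaces the Jacobian factor `|sinh (s - t)|` by the kernel `|s - t|` of the far estimate. -/
theorem edist_le_ofReal_sinh (s t : ℝ) : edist s t ≤ ENNReal.ofReal |Real.sinh (s - t)| := by
  rw [edist_dist, Real.dist_eq]
  apply ENNReal.ofReal_le_ofReal
  rcases le_total 0 (s - t) with h | h
  · rw [abs_of_nonneg h]
    exact (Real.self_le_sinh_iff.2 h).trans (le_abs_self _)
  · rw [abs_of_nonpos h]
    have := Real.self_le_sinh_iff.2 (neg_nonneg.2 h)
    rw [Real.sinh_neg] at this
    exact this.trans (neg_le_abs _)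

/-- The dual estimate for the far pairs, for fixed first coordinates. -/
theorem lintegral_far_hypSum_le {u v : ℝ → ℝ≥0∞} (hu : Measurable u) (hv : Measurable v) {a : ℝ}
    (ha : 0 < a) (ha1 : a < 1) {κ : ℝ≥0∞} (hκ : κ ≠ 0) (hκ' : κ ≠ ⊤) (hui : ∀ s, u s ≠ ⊤)
    (hvi : ∀ s, v s ≠ ⊤) (hu' : ∫⁻ x, u x ≠ ⊤) (hv' : ∫⁻ x, v x ≠ ⊤) {ξ η : ℝ}
    (hξ : ξ ^ 2 - 1 ≠ 0) (hη : η ^ 2 - 1 ≠ 0) {h : ℝ × ℝ → ℝ≥0∞} (hh : Measurable h) :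
    ∫⁻ p in {p : ℝ × ℝ | κ * (∫⁻ x, v x) * u p.1 ≤ edist p.1 p.2 ∧
        κ * (∫⁻ x, u x) * v p.2 ≤ edist p.1 p.2},
        u p.1 ^ (1 / 4 + a / 2) * v p.2 ^ (1 / 4 + a / 2)
          * h (hypSum √|ξ ^ 2 - 1| √|η ^ 2 - 1| p) ^ (1 / 2 : ℝ)
      ≤ (4 * farConst a * κ ^ (-a)) ^ (1 / 2 : ℝ) * ((∫⁻ x, u x) ^ (1 / 4 : ℝ)
          * (∫⁻ x, v x) ^ (1 / 4 : ℝ) * (∫⁻ w, h w) ^ (1 / 2 : ℝ)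
          * (hypWeight ξ * hypWeight η)) := by
  have far := lintegral_far_le hu hv ha ha1 hκ hκ' hui hvi hu' hv'
  set β := ∫⁻ x, u x
  set β' := ∫⁻ x, v x
  set m := √|ξ ^ 2 - 1|
  set m' := √|η ^ 2 - 1|
  have hm : 0 < m := Real.sqrt_pos.2 (abs_pos.2 hξ)
  have hm' : 0 < m' := Real.sqrt_pos.2 (abs_pos.2 hη)
  set S : Set (ℝ × ℝ) := {p | κ * β' * u p.1 ≤ edist p.1 p.2 ∧ κ * β * v p.2 ≤ edist p.1 p.2}
  have hS : MeasurableSet S := by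
    have h1 : MeasurableSet {p : ℝ × ℝ | κ * β' * u p.1 ≤ edist p.1 p.2} :=
      measurableSet_le (by fun_prop) (by fun_prop)
    have h2 : MeasurableSet {p : ℝ × ℝ | κ * β * v p.2 ≤ edist p.1 p.2} :=
      measurableSet_le (by fun_prop) (by fun_prop)
    exact h1.inter h2
  have hsum : Measurable (hypSum m m') := by unfold hypSum; fun_prop
  set J : ℝ × ℝ → ℝ≥0∞ := fun p => ENNReal.ofReal (m * m' * |Real.sinh (p.1 - p.2)|) with hJ
  -- The integrand is split for Cauchy–Schwarz by multiplying and dividing by the square root of the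
  -- Jacobian `J`. One factor then changes variables to `∫ h`, the other is the far integral. The
  -- diagonal, where `J = 0`, is null.
  have hpt : ∀ᵐ p ∂(volume.restrict S), u p.1 ^ (1 / 4 + a / 2) * v p.2 ^ (1 / 4 + a / 2)
          * h (hypSum m m' p) ^ (1 / 2 : ℝ)
      ≤ (J p * h (hypSum m m' p)) ^ (1 / 2 : ℝ) * ((ENNReal.ofReal (m * m'))⁻¹
          * (u p.1 ^ (1 / 2 + a) * (v p.2 ^ (1 / 2 + a) * (edist p.1 p.2)⁻¹))) ^ (1 / 2 : ℝ) := by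
    refine ae_restrict_of_ae ?_
    filter_upwards [ae_fst_ne_snd] with p hp
    have hsq : ∀ x : ℝ≥0∞, (x ^ (1 / 2 + a)) ^ (1 / 2 : ℝ) = x ^ (1 / 4 + a / 2) := by
      intro x; rw [← ENNReal.rpow_mul]; congr 1; ring
    have hnn : (0 : ℝ) ≤ 1 / 2 := by norm_num
    simp only [ENNReal.mul_rpow_of_nonneg _ _ hnn, hsq]
    have hone : 1 ≤ J p ^ (1 / 2 : ℝ) * ((ENNReal.ofReal (m * m'))⁻¹ ^ (1 / 2 : ℝ)
        * (edist p.1 p.2)⁻¹ ^ (1 / 2 : ℝ)) := by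
      rw [← ENNReal.mul_rpow_of_nonneg _ _ hnn, ← ENNReal.mul_rpow_of_nonneg _ _ hnn]
      apply ENNReal.one_le_rpow _ (by norm_num)
      have hmm : 0 < m * m' := mul_pos hm hm'
      have hed : edist p.1 p.2 ≠ 0 := by simpa using hp
      calc (1 : ℝ≥0∞) = (ENNReal.ofReal (m * m') * edist p.1 p.2)
            * ((ENNReal.ofReal (m * m'))⁻¹ * (edist p.1 p.2)⁻¹) := by
            rw [mul_mul_mul_comm, ENNReal.mul_inv_cancel (by simpa using hmm)
              ENNReal.ofReal_ne_top, ENNReal.mul_inv_cancel hed (edist_ne_top _ _), one_mul]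
        _ ≤ _ := by
            refine mul_le_mul_left ?_ _
            rw [hJ]; simp only
            rw [ENNReal.ofReal_mul hmm.le]
            exact mul_le_mul_right (edist_le_ofReal_sinh _ _) _
    calc _ = u p.1 ^ (1 / 4 + a / 2) * v p.2 ^ (1 / 4 + a / 2)
          * h (hypSum m m' p) ^ (1 / 2 : ℝ) * 1 := by rw [mul_one]
      _ ≤ _ := mul_le_mul_right hone _
      _ = _ := by ring
  refine (lintegral_mono_ae hpt).trans ?_
  refine (ENNReal.lintegral_mul_norm_pow_le (by fun_prop) (by fun_prop) (by norm_num)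
    (by norm_num) (by norm_num)).trans ?_
  have b1 : ∫⁻ p in S, J p * h (hypSum m m' p) ≤ 2 * ∫⁻ w, h w :=
    (setLIntegral_le_lintegral _ _).trans (lintegral_hypSum_le hm hm' h)
  have b2 : ∫⁻ p in S, (ENNReal.ofReal (m * m'))⁻¹
          * (u p.1 ^ (1 / 2 + a) * (v p.2 ^ (1 / 2 + a) * (edist p.1 p.2)⁻¹))
      ≤ (ENNReal.ofReal (m * m'))⁻¹ * (2 * farConst a * κ ^ (-a)
          * (β ^ (1 / 2 : ℝ) * β' ^ (1 / 2 : ℝ))) := by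
    rw [lintegral_const_mul _ (by fun_prop)]
    refine mul_le_mul_right (le_trans ?_ far) _
    rw [← lintegral_indicator hS,
      lintegral_lintegral_reorder (Measurable.indicator (by fun_prop) hS)]
    exact lintegral_mono fun s => (setLIntegral_prodMk_left hS _ s).le
  refine (mul_le_mul' (ENNReal.rpow_le_rpow b1 (by norm_num))
    (ENNReal.rpow_le_rpow b2 (by norm_num))).trans (le_of_eq ?_)
  have hnn : (0 : ℝ) ≤ 1 / 2 := by norm_num
  rw [← hypWeight_mul_hypWeight hξ hη, ← ENNReal.mul_rpow_of_nonneg _ _ hnn,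
    show ∀ x : ℝ≥0∞, x ^ (1 / 4 : ℝ) = (x ^ (1 / 2 : ℝ)) ^ (1 / 2 : ℝ) from fun x => by
      rw [← ENNReal.rpow_mul]; norm_num,
    show ∀ x : ℝ≥0∞, x ^ (1 / 4 : ℝ) = (x ^ (1 / 2 : ℝ)) ^ (1 / 2 : ℝ) from fun x => by
      rw [← ENNReal.rpow_mul]; norm_num]
  simp only [← ENNReal.mul_rpow_of_nonneg _ _ hnn]
  congr 1
  ring

/-- The slicewise estimate leaves the slice masses to the power `1/4`, the slice integral of `h` at
`ξ + η` to the power `1/2`, and the weights `hypWeight`: exactly the integrand of the convolution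
inequality. -/
theorem setLIntegral_farSet_le {u : ℝ × ℝ → ℝ≥0∞} (hu : Measurable u) (hui : ∀ ρ, u ρ ≠ ⊤)
    (hN : ∫⁻ ρ, u ρ ≠ ⊤) {a : ℝ} (ha : 0 < a) (ha1 : a < 1) {κ : ℝ≥0∞} (hκ : κ ≠ 0)
    (hκ' : κ ≠ ⊤) {h : ℝ × ℝ × ℝ → ℝ≥0∞} (hh : Measurable h) :
    ∫⁻ x in farSet u κ, u x.1 ^ (1 / 4 + a / 2) * u x.2 ^ (1 / 4 + a / 2)
          * h (hypParam x.1 + hypParam x.2) ^ (1 / 2 : ℝ)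
      ≤ (4 * farConst a * κ ^ (-a)) ^ (1 / 2 : ℝ) * (4 * convConst)
          * ((∫⁻ ρ, u ρ) ^ (1 / 2 : ℝ) * (∫⁻ w, h w) ^ (1 / 2 : ℝ)) := by
  have hβ : Measurable fun ξ => ∫⁻ s, u (ξ, s) := hu.lintegral_prod_right'
  have hH : Measurable fun x => ∫⁻ w, h (x, w) := hh.lintegral_prod_right'
  have hfar := measurableSet_farSet hu κ
  have hN' : ∫⁻ ξ, ∫⁻ s, u (ξ, s) ≠ ⊤ := by rwa [← lintegral_lintegral_reorder hu]
  have hfin : ∀ᵐ ξ : ℝ, ∫⁻ s, u (ξ, s) ≠ ⊤ := (ae_lt_top hβ hN').mono fun _ h => h.ne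
  have hone : ∀ᵐ ξ : ℝ, ξ ^ 2 - 1 ≠ 0 := by
    have h1 : ∀ᵐ ξ : ℝ, ξ ≠ 1 := by simp [ae_iff]
    have h2 : ∀ᵐ ξ : ℝ, ξ ≠ -1 := by simp [ae_iff]
    filter_upwards [h1, h2] with ξ h1 h2 h
    have : (ξ - 1) * (ξ + 1) = 0 := by linear_combination h
    rcases mul_eq_zero.1 this with h | h
    · exact h1 (by linarith)
    · exact h2 (by linarith)
  rw [← lintegral_indicator hfar,
    lintegral_prod_prod_reorder (Measurable.indicator (by fun_prop) hfar)]
  have step : ∀ᵐ ξ : ℝ, ∀ᵐ η : ℝ, ∫⁻ s, ∫⁻ t, (farSet u κ).indicator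
        (fun x => u x.1 ^ (1 / 4 + a / 2) * u x.2 ^ (1 / 4 + a / 2)
          * h (hypParam x.1 + hypParam x.2) ^ (1 / 2 : ℝ)) ((ξ, s), (η, t))
      ≤ (4 * farConst a * κ ^ (-a)) ^ (1 / 2 : ℝ) * ((∫⁻ s, u (ξ, s)) ^ (1 / 4 : ℝ)
          * (∫⁻ s, u (η, s)) ^ (1 / 4 : ℝ) * (∫⁻ w, h (ξ + η, w)) ^ (1 / 2 : ℝ)
          * (hypWeight ξ * hypWeight η)) := by
    filter_upwards [hfin, hone] with ξ h1 h2
    filter_upwards [hfin, hone] with η h3 h4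
    refine le_trans ?_ (lintegral_far_hypSum_le (u := fun s => u (ξ, s)) (v := fun s => u (η, s))
      (by fun_prop) (by fun_prop) ha ha1 hκ hκ' (fun _ => hui _) (fun _ => hui _) h1 h3 h2 h4
      (h := fun w => h (ξ + η, w)) (by fun_prop))
    have hm : Measurable fun p : ℝ × ℝ => ((ξ, p.1), (η, p.2)) := by fun_prop
    have hset : MeasurableSet {p : ℝ × ℝ | κ * (∫⁻ s, u (η, s)) * u (ξ, p.1) ≤ edist p.1 p.2 ∧
        κ * (∫⁻ s, u (ξ, s)) * u (η, p.2) ≤ edist p.1 p.2} := hm hfar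
    rw [← lintegral_indicator hset, ← lintegral_lintegral_reorder
      (F := fun p => (farSet u κ).indicator
        (fun x => u x.1 ^ (1 / 4 + a / 2) * u x.2 ^ (1 / 4 + a / 2)
          * h (hypParam x.1 + hypParam x.2) ^ (1 / 2 : ℝ)) ((ξ, p.1), (η, p.2)))
      ((Measurable.indicator (by fun_prop) hfar).comp hm)]
    exact le_rfl
  refine (lintegral_mono_ae (step.mono fun ξ hξ => lintegral_mono_ae hξ)).trans ?_
  have e1 : ∀ ξ : ℝ, ∫⁻ η, (4 * farConst a * κ ^ (-a)) ^ (1 / 2 : ℝ)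
        * ((∫⁻ s, u (ξ, s)) ^ (1 / 4 : ℝ)
          * (∫⁻ s, u (η, s)) ^ (1 / 4 : ℝ) * (∫⁻ w, h (ξ + η, w)) ^ (1 / 2 : ℝ)
          * (hypWeight ξ * hypWeight η))
      = (4 * farConst a * κ ^ (-a)) ^ (1 / 2 : ℝ) * ∫⁻ η, ((∫⁻ s, u (ξ, s)) ^ (1 / 4 : ℝ)
          * (∫⁻ s, u (η, s)) ^ (1 / 4 : ℝ) * (∫⁻ w, h (ξ + η, w)) ^ (1 / 2 : ℝ)
          * (hypWeight ξ * hypWeight η)) := fun ξ => lintegral_const_mul _ (by fun_prop)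
  simp_rw [e1]
  rw [lintegral_const_mul _ (by fun_prop)]
  refine (mul_le_mul_right (lintegral_hypWeight_conv_le hβ hβ hH) _).trans (le_of_eq ?_)
  rw [← lintegral_lintegral_reorder hu,
    show ∫⁻ x, ∫⁻ w, h (x, w) = ∫⁻ w, h w by
      rw [Measure.volume_eq_prod ℝ (ℝ × ℝ), lintegral_prod _ hh.aemeasurable],
    ← ENNReal.rpow_add_of_nonneg _ _ (by norm_num) (by norm_num)]
  norm_num only
  ring

/-! ### The operator, its square and the bilinear `L²` bound -/

/-- The extension operator of a piece of the hyperboloid, in the coordinates of `hypParam`. -/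
noncomputable def hypOp (g : ℝ × ℝ → ℂ) (z : ℝ × ℝ × ℝ) : ℂ :=
  ∫ w, Complex.exp (Complex.I * (dot3 z (hypParam w) : ℝ)) * g w

/-- The part of `hypOp g ^ 2` that comes from the pairs of points in `S`. -/
noncomputable def hypPairOp (g : ℝ × ℝ → ℂ) (S : Set ((ℝ × ℝ) × (ℝ × ℝ))) (z : ℝ × ℝ × ℝ) : ℂ :=
  ∫ x in S, Complex.exp (Complex.I * (dot3 z (hypParam x.1 + hypParam x.2) : ℝ))
    * (g x.1 * g x.2)

theorem enorm_exp_I_mul_ofReal (r : ℝ) : ‖Complex.exp (Complex.I * (r : ℂ))‖ₑ = 1 := by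
  rw [← ofReal_norm, mul_comm, Complex.norm_exp_ofReal_mul_I]; simp

theorem integrable_exp_mul {α : Type*} [MeasurableSpace α] {μ : Measure α} {g : α → ℂ}
    (hg : Integrable g μ) {r : α → ℝ} (hr : Measurable r) :
    Integrable (fun x => Complex.exp (Complex.I * (r x : ℂ)) * g x) μ := by
  refine hg.mono (AEStronglyMeasurable.mul (by fun_prop) hg.1) (Filter.Eventually.of_forall
    fun x => ?_)
  rw [norm_mul, mul_comm Complex.I, Complex.norm_exp_ofReal_mul_I, one_mul]

theorem integrable_pair {g : ℝ × ℝ → ℂ} (hi : Integrable g) :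
    Integrable fun x : (ℝ × ℝ) × (ℝ × ℝ) => g x.1 * g x.2 := by
  rw [Measure.volume_eq_prod]
  exact hi.mul_prod hi

theorem hypOp_sq {g : ℝ × ℝ → ℂ} (hi : Integrable g) {S : Set ((ℝ × ℝ) × (ℝ × ℝ))}
    (hS : MeasurableSet S) (z : ℝ × ℝ × ℝ) :
    hypOp g z ^ 2 = hypPairOp g S z + hypPairOp g Sᶜ z := by
  unfold hypPairOp
  rw [integral_add_compl hS (integrable_exp_mul (integrable_pair hi) (by fun_prop)), sq, hypOp,
    ← integral_prod_mul, Measure.volume_eq_prod (ℝ × ℝ) (ℝ × ℝ)]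
  refine integral_congr_ae (Filter.Eventually.of_forall fun x => ?_)
  simp only [dot3_add]
  rw [Complex.ofReal_add, mul_add, Complex.exp_add]
  ring

theorem enorm_hypPairOp_le (g : ℝ × ℝ → ℂ) (S : Set ((ℝ × ℝ) × (ℝ × ℝ))) (z : ℝ × ℝ × ℝ) :
    ‖hypPairOp g S z‖ₑ ≤ ∫⁻ x in S, ‖g x.1‖ₑ * ‖g x.2‖ₑ := by
  refine (enorm_integral_le_lintegral_enorm _).trans (le_of_eq ?_)
  simp only [enorm_mul, enorm_exp_I_mul_ofReal, one_mul]

theorem lintegral_pair_ne_top {g : ℝ × ℝ → ℂ} (hi : Integrable g) (S : Set ((ℝ × ℝ) × (ℝ × ℝ))) :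
    ∫⁻ x in S, ‖g x.1‖ₑ * ‖g x.2‖ₑ ≠ ⊤ := by
  have := (integrable_pair hi).2
  rw [hasFiniteIntegral_iff_enorm] at this
  simp only [enorm_mul] at this
  exact ((setLIntegral_le_lintegral _ _).trans_lt this).ne

theorem stronglyMeasurable_hypPairOp {g : ℝ × ℝ → ℂ} (hg : Measurable g)
    (S : Set ((ℝ × ℝ) × (ℝ × ℝ))) : StronglyMeasurable (hypPairOp g S) := by
  unfold hypPairOp
  apply StronglyMeasurable.integral_prod_right
    (f := fun z (x : (ℝ × ℝ) × (ℝ × ℝ)) =>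
      Complex.exp (Complex.I * (dot3 z (hypParam x.1 + hypParam x.2) : ℝ)) * (g x.1 * g x.2))
  apply Measurable.stronglyMeasurable
  unfold Function.uncurry
  fun_prop

/-- An `L²` bound for `hypPairOp` by duality. -/
theorem lintegral_hypPairOp_sq_le {g : ℝ × ℝ → ℂ} (hg : Measurable g) (hi : Integrable g)
    (S : Set ((ℝ × ℝ) × (ℝ × ℝ))) (D : ℝ≥0∞)
    (hD : ∀ h : ℝ × ℝ × ℝ → ℝ≥0∞, Measurable h →
      ∫⁻ x in S, ‖g x.1‖ₑ * ‖g x.2‖ₑ * h (hypParam x.1 + hypParam x.2) ^ (1 / 2 : ℝ)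
        ≤ D * (∫⁻ w, h w) ^ (1 / 2 : ℝ)) :
    ∫⁻ z, ‖hypPairOp g S z‖ₑ ^ 2 ≤ ENNReal.ofReal ((2 * Real.pi) ^ 3) * D ^ 2 := by
  have hIm := stronglyMeasurable_hypPairOp hg S
  set I := hypPairOp g S with hIdef
  set M := ∫⁻ x in S, ‖g x.1‖ₑ * ‖g x.2‖ₑ
  have hM : M ≠ ⊤ := lintegral_pair_ne_top hi S
  have hIM : ∀ z, ‖I z‖ₑ ≤ M := enorm_hypPairOp_le g S
  have hIM' : ∀ z, ‖I z‖ ≤ M.toReal := fun z => by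
    have := ENNReal.toReal_mono hM (hIM z)
    rwa [toReal_enorm] at this
  -- `I` is bounded, so on a set of finite measure its square integral `X` is finite and may later
  -- be cancelled.
  refine lintegral_le_of_forall_fin_meas_le _
    fun B hB hBfin => ?_
  have : IsFiniteMeasure (volume.restrict B) := ⟨by
    rw [Measure.restrict_apply_univ]; exact hBfin.lt_top⟩
  -- The test function is the conjugate of `I` on `B`: pairing it with `I` gives `X`. By Fubini this
  -- is the integral of `g ⊗ g` against the Fourier integral `F` of `φ` at sums of points, to which
  -- `hD` applies with `h = |F|²`.
  set φ : ℝ × ℝ × ℝ → ℂ := B.indicator fun z => (starRingEnd ℂ) (I z) with hφ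
  have hφp : ∀ p : ℝ≥0∞, MemLp φ p := by
    intro p
    rw [hφ, memLp_indicator_iff_restrict hB]
    refine MemLp.of_bound (Complex.continuous_conj.comp_stronglyMeasurable hIm).aestronglyMeasurable
      M.toReal (Filter.Eventually.of_forall fun z => ?_)
    simpa using hIM' z
  have hφi : Integrable φ := memLp_one_iff_integrable.1 (hφp 1)
  set X := ∫⁻ z in B, ‖I z‖ₑ ^ 2 with hX
  have hXfin : X ≠ ⊤ := by
    have : X ≤ ∫⁻ z in B, M ^ 2 := lintegral_mono fun z => pow_le_pow_left₀ zero_le (hIM z) 2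
    rw [setLIntegral_const] at this
    exact ne_top_of_le_ne_top (ENNReal.mul_ne_top (ENNReal.pow_ne_top hM) hBfin) this
  have hφX : ∫⁻ z, ‖φ z‖ₑ ^ 2 = X := by
    rw [hX, ← lintegral_indicator hB]
    refine lintegral_congr fun z => ?_
    by_cases hz : z ∈ B
    · simp [hφ, hz]
    · simp [hφ, hz]
  have hXeq : ‖∫ z, φ z * I z‖ₑ = X := by
    have e1 : ∀ z, φ z * I z = ((B.indicator (fun z => ‖I z‖ ^ 2) z : ℝ) : ℂ) := by
      intro z
      by_cases hz : z ∈ B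
      · simp only [hφ, Set.indicator_of_mem hz]
        rw [mul_comm, Complex.mul_conj, Complex.normSq_eq_norm_sq]
      · simp only [hφ, Set.indicator_of_notMem hz]; simp
    simp_rw [e1]
    rw [integral_complex_ofReal, integral_indicator hB, ← ofReal_norm, Complex.norm_real,
      Real.norm_eq_abs, abs_of_nonneg (integral_nonneg fun z => by positivity),
      ofReal_integral_eq_lintegral_ofReal]
    · refine lintegral_congr fun z => ?_
      rw [ENNReal.ofReal_pow (norm_nonneg _), ofReal_norm]
    · refine Integrable.of_bound (hIm.norm.pow 2).aestronglyMeasurable (M.toReal ^ 2)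
        (Filter.Eventually.of_forall fun z => ?_)
      rw [norm_pow, norm_norm]
      exact pow_le_pow_left₀ (norm_nonneg _) (hIM' z) 2
    · exact Filter.Eventually.of_forall fun z => by positivity
  set F : ℝ × ℝ × ℝ → ℂ := fun w => ∫ z, Complex.exp (Complex.I * (dot3 z w : ℝ)) * φ z
  have hFm : Measurable F := by
    have : StronglyMeasurable F := by
      apply StronglyMeasurable.integral_prod_right
        (f := fun w z => Complex.exp (Complex.I * (dot3 z w : ℝ)) * φ z)
      apply Measurable.stronglyMeasurable
      unfold Function.uncurry
      fun_prop
    exact this.measurable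
  have hswap : ∫ z, φ z * I z = ∫ x in S, (g x.1 * g x.2) * F (hypParam x.1 + hypParam x.2) := by
    have e1 : ∀ z, φ z * I z = ∫ x in S, φ z * (Complex.exp (Complex.I *
        (dot3 z (hypParam x.1 + hypParam x.2) : ℝ)) * (g x.1 * g x.2)) := fun z => by
      rw [integral_const_mul]; rfl
    simp_rw [e1]
    rw [integral_integral_swap]
    · refine integral_congr_ae (Filter.Eventually.of_forall fun x => ?_)
      simp only [F]
      rw [← integral_const_mul]
      refine integral_congr_ae (Filter.Eventually.of_forall fun z => ?_)
      simp only
      ring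
    · have h1 : Integrable (fun y : (ℝ × ℝ × ℝ) × ((ℝ × ℝ) × (ℝ × ℝ)) =>
          φ y.1 * (g y.2.1 * g y.2.2)) (volume.prod (volume.restrict S)) :=
        hφi.mul_prod (integrable_pair hi).integrableOn
      refine (integrable_exp_mul h1 (r := fun y => dot3 y.1 (hypParam y.2.1 + hypParam y.2.2))
        (by fun_prop)).congr (Filter.Eventually.of_forall fun y => ?_)
      simp only [Function.uncurry]
      ring
  have hbound : X ≤ D * (ENNReal.ofReal ((2 * Real.pi) ^ 3) * X) ^ (1 / 2 : ℝ) := by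
    calc X = ‖∫ x in S, (g x.1 * g x.2) * F (hypParam x.1 + hypParam x.2)‖ₑ := by
          rw [← hswap, hXeq]
      _ ≤ ∫⁻ x in S, ‖g x.1‖ₑ * ‖g x.2‖ₑ * (‖F (hypParam x.1 + hypParam x.2)‖ₑ ^ 2) ^
          (1 / 2 : ℝ) := by
          refine (enorm_integral_le_lintegral_enorm _).trans (le_of_eq ?_)
          refine lintegral_congr fun x => ?_
          rw [enorm_mul, enorm_mul, ← ENNReal.rpow_natCast, ← ENNReal.rpow_mul]
          norm_num
      _ ≤ D * (∫⁻ w, ‖F w‖ₑ ^ 2) ^ (1 / 2 : ℝ) := hD (fun w => ‖F w‖ₑ ^ 2) (by fun_prop)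
      _ ≤ _ := by
          refine mul_le_mul_right (ENNReal.rpow_le_rpow ?_ (by norm_num)) _
          rw [← hφX]
          exact lintegral_enorm_fourierExp_sq_le hφi (hφp 2)
  rcases eq_or_ne X 0 with h0 | h0
  · rw [h0]; exact zero_le
  have hsqrt : ∀ x : ℝ≥0∞, (x ^ (1 / 2 : ℝ)) ^ 2 = x := fun x => by
    rw [← ENNReal.rpow_natCast, ← ENNReal.rpow_mul]; norm_num
  have h2 := pow_le_pow_left₀ zero_le hbound 2
  rw [mul_pow, hsqrt, sq X] at h2
  have h3 : X * X ≤ (ENNReal.ofReal ((2 * Real.pi) ^ 3) * D ^ 2) * X := by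
    refine h2.trans (le_of_eq ?_); ring
  exact (ENNReal.mul_le_mul_iff_left h0 hXfin).1 h3

theorem hypOp_eq_zero_of_lintegral_eq_zero {g : ℝ × ℝ → ℂ} (hg : Measurable g) {p : ℝ} (hp : 0 < p)
    (h : ∫⁻ w, ‖g w‖ₑ ^ p = 0) (z : ℝ × ℝ × ℝ) : hypOp g z = 0 := by
  rw [lintegral_eq_zero_iff (by fun_prop)] at h
  refine integral_eq_zero_of_ae ?_
  filter_upwards [h] with w hw
  have : ‖g w‖ₑ = 0 := by simpa [ENNReal.rpow_eq_zero_iff, hp, hp.not_gt] using hw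
  rw [enorm_eq_zero.1 this]; simp

/-! ### The weak-type estimate -/

/-- The identity between exponents behind the choice of the threshold in `hypOp_weak_type`. -/
theorem threshold_rpow_identity {p a l n : ℝ} (hp : 1 < p) (ha : 2 * p * a = 4 - p) (hl : 0 < l)
    (hn : 0 < n) :
    (1 / 2 * (l ^ 2 / (4 * n ^ 2)) ^ (p / (p - 1))) ^ (-a) * (n / (l ^ 4 / 4))
      = (1 / 2 * (1 / 4 : ℝ) ^ (p / (p - 1))) ^ (-a) * 4
        * (l ^ (-(3 * p / (p - 1))) * n ^ (3 / (p - 1))) := by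
  have hp1 : p - 1 ≠ 0 := by linarith
  have e1 : l ^ 2 / (4 * n ^ 2) = 1 / 4 * (l ^ (2 : ℝ) * n ^ (-2 : ℝ)) := by
    rw [Real.rpow_neg hn.le]; norm_cast; field_simp
  have e5 : (1 / 2 * (1 / 4 * (l ^ (2 : ℝ) * n ^ (-2 : ℝ))) ^ (p / (p - 1))) ^ (-a)
      = (1 / 2 * (1 / 4 : ℝ) ^ (p / (p - 1))) ^ (-a)
        * (l ^ (2 * (p / (p - 1)) * -a) * n ^ (-2 * (p / (p - 1)) * -a)) := by
    rw [Real.mul_rpow (x := 1 / 4) (by norm_num) (by positivity),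
      Real.mul_rpow (x := l ^ (2 : ℝ)) (by positivity) (by positivity), ← mul_assoc,
      Real.mul_rpow (x := 1 / 2 * (1 / 4 : ℝ) ^ (p / (p - 1))) (by positivity) (by positivity),
      Real.mul_rpow (x := (l ^ (2 : ℝ)) ^ (p / (p - 1))) (by positivity) (by positivity),
      ← Real.rpow_mul hl.le, ← Real.rpow_mul hl.le, ← Real.rpow_mul hn.le, ← Real.rpow_mul hn.le]
  have e2 : n / (l ^ 4 / 4) = 4 * (l ^ (-4 : ℝ) * n ^ (1 : ℝ)) := by
    rw [Real.rpow_neg hl.le, Real.rpow_one]; norm_cast; field_simp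
  have e3 : l ^ (-(3 * p / (p - 1))) = l ^ (2 * (p / (p - 1)) * -a) * l ^ (-4 : ℝ) := by
    rw [← Real.rpow_add hl]; congr 1; field_simp; linear_combination ha
  have e4 : n ^ (3 / (p - 1)) = n ^ (-2 * (p / (p - 1)) * -a) * n ^ (1 : ℝ) := by
    rw [← Real.rpow_add hn]; congr 1; field_simp; linear_combination -ha
  rw [e1, e5, e2, e3, e4]; ring

/-- Where `|hypOp g| > l`, the far part of the square exceeds `l² / 2`, since `κ` is chosen to keep
the near part below that. Chebyshev with the far `L²` bound does the rest. The power of `∫ |g|^p`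
makes the right side homogeneous of degree `3p/(p - 1)` in `g`. -/
theorem hypOp_weak_type {p : ℝ} (hp : 2 ≤ p) (hp4 : p < 4) :
    ∃ C : ℝ≥0∞, C ≠ ⊤ ∧ ∀ g : ℝ × ℝ → ℂ, Measurable g → Integrable g →
      ∫⁻ w, ‖g w‖ₑ ^ p ≠ ⊤ → ∀ l : ℝ, 0 < l →
      volume {z | ENNReal.ofReal l < ‖hypOp g z‖ₑ}
        ≤ C * (ENNReal.ofReal (l ^ (-(3 * p / (p - 1))))
          * (∫⁻ w, ‖g w‖ₑ ^ p) ^ (3 / (p - 1))) := by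
  -- Cauchy–Schwarz squares `|g| = u^(1/p)`, and `2/p = 1/2 + a` is the power in the far estimate.
  -- Its positivity is the condition `p < 4`.
  set a : ℝ := 2 / p - 1 / 2 with ha_def
  have hp0 : 0 < p := by linarith
  have ha : 0 < a := by
    rw [ha_def, sub_pos, div_lt_div_iff₀ (by norm_num) hp0]; linarith
  have ha1 : a < 1 := by
    have : 2 / p ≤ 1 := by rw [div_le_one hp0]; exact hp
    linarith
  have hap : 2 * p * a = 4 - p := by rw [ha_def]; field_simp; ring
  have hpa : 1 / p = 1 / 4 + a / 2 := by rw [ha_def]; field_simp; ring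
  set K : ℝ≥0∞ := ENNReal.ofReal ((2 * Real.pi) ^ 3) * (4 * farConst a * (4 * convConst) ^ 2)
  set c : ℝ := (1 / 2 * (1 / 4 : ℝ) ^ (p / (p - 1))) ^ (-a) * 4 with hc
  refine ⟨K * ENNReal.ofReal c, ?_, ?_⟩
  · refine ENNReal.mul_ne_top (ENNReal.mul_ne_top ENNReal.ofReal_ne_top (ENNReal.mul_ne_top
      (ENNReal.mul_ne_top (by norm_num) (farConst_ne_top ha1)) (ENNReal.pow_ne_top
      (ENNReal.mul_ne_top (by norm_num) convConst_ne_top)))) ENNReal.ofReal_ne_top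
  intro g hg hi hN l hl
  set u : ℝ × ℝ → ℝ≥0∞ := fun w => ‖g w‖ₑ ^ p with hu_def
  have hu : Measurable u := by fun_prop
  have hui : ∀ w, u w ≠ ⊤ := fun w => ENNReal.rpow_ne_top_of_nonneg hp0.le enorm_ne_top
  have hgu : ∀ w, u w ^ (1 / p) = ‖g w‖ₑ := fun w => by
    rw [hu_def]; simp only; rw [← ENNReal.rpow_mul, mul_one_div_cancel hp0.ne', ENNReal.rpow_one]
  set N := ∫⁻ w, u w with hN_def
  rcases eq_or_ne N 0 with h0 | h0
  · have : {z | ENNReal.ofReal l < ‖hypOp g z‖ₑ} = ∅ := by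
      ext z; simp [hypOp_eq_zero_of_lintegral_eq_zero hg hp0 h0]
    rw [this]; simp
  set n := N.toReal
  have hn : 0 < n := ENNReal.toReal_pos h0 hN
  have hNn : N = ENNReal.ofReal n := (ENNReal.ofReal_toReal hN).symm
  -- The solution of `2 (2k)^(1 - 1/p) n² = l² / 2`, which makes the bound for the near pairs equal
  -- to half of `l²`.
  set k : ℝ := 1 / 2 * (l ^ 2 / (4 * n ^ 2)) ^ (p / (p - 1)) with hk_def
  have hk : 0 < k := by positivity
  set κ := ENNReal.ofReal k
  have hκ : κ ≠ 0 := by simpa [κ] using hk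
  have hκ' : κ ≠ ⊤ := ENNReal.ofReal_ne_top
  have hfar := measurableSet_farSet hu κ
  have near : ∫⁻ x in (farSet u κ)ᶜ, ‖g x.1‖ₑ * ‖g x.2‖ₑ ≤ ENNReal.ofReal (l ^ 2 / 2) := by
    have h := setLIntegral_compl_farSet_le hu (by linarith : 1 < p) κ
    simp only [hgu] at h
    refine h.trans (le_of_eq ?_)
    have e2 : (2 * κ) ^ (1 - 1 / p) = ENNReal.ofReal (l ^ 2 / (4 * n ^ 2)) := by
      rw [show (2 : ℝ≥0∞) = ENNReal.ofReal 2 by simp, ← ENNReal.ofReal_mul (by norm_num),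
        ENNReal.ofReal_rpow_of_pos (by positivity)]
      congr 1
      rw [hk_def, ← mul_assoc, show (2 : ℝ) * (1 / 2) = 1 by norm_num, one_mul,
        ← Real.rpow_mul (by positivity)]
      have hp1 : p - 1 ≠ 0 := by linarith
      rw [show p / (p - 1) * (1 - 1 / p) = 1 by field_simp, Real.rpow_one]
    rw [e2, ← hN_def, hNn, ← ENNReal.ofReal_pow hn.le, show (2 : ℝ≥0∞) = ENNReal.ofReal 2 by simp,
      ← ENNReal.ofReal_mul (by norm_num), ← ENNReal.ofReal_mul (by positivity)]
    congr 1
    field_simp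
    norm_num
  set D : ℝ≥0∞ := (4 * farConst a * κ ^ (-a)) ^ (1 / 2 : ℝ) * (4 * convConst) * N ^ (1 / 2 : ℝ)
  have far : ∫⁻ z, ‖hypPairOp g (farSet u κ) z‖ₑ ^ 2
      ≤ ENNReal.ofReal ((2 * Real.pi) ^ 3) * D ^ 2 := by
    refine lintegral_hypPairOp_sq_le hg hi _ D fun h hh => ?_
    have := setLIntegral_farSet_le hu hui hN ha ha1 hκ hκ' hh
    rw [← hpa] at this
    simp only [hgu] at this
    refine this.trans (le_of_eq ?_)
    simp only [D]; ring
  have hD : ENNReal.ofReal ((2 * Real.pi) ^ 3) * D ^ 2 = K * (κ ^ (-a) * N) := by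
    have hsqrt : ∀ x : ℝ≥0∞, (x ^ (1 / 2 : ℝ)) ^ 2 = x := fun x => by
      rw [← ENNReal.rpow_natCast, ← ENNReal.rpow_mul]; norm_num
    simp only [D, K]
    rw [mul_pow _ (N ^ (1 / 2 : ℝ)), mul_pow _ (4 * convConst), hsqrt, hsqrt]; ring
  have hsub : {z | ENNReal.ofReal l < ‖hypOp g z‖ₑ}
      ⊆ {z | ENNReal.ofReal (l ^ 4 / 4) ≤ ‖hypPairOp g (farSet u κ) z‖ₑ ^ 2} := by
    intro z hz
    have hz : ENNReal.ofReal l < ‖hypOp g z‖ₑ := hz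
    have h1 : ENNReal.ofReal (l ^ 2 / 2) + ENNReal.ofReal (l ^ 2 / 2)
        ≤ ‖hypPairOp g (farSet u κ) z‖ₑ + ENNReal.ofReal (l ^ 2 / 2) := by
      rw [← ENNReal.ofReal_add (by positivity) (by positivity), add_halves,
        ENNReal.ofReal_pow hl.le]
      calc ENNReal.ofReal l ^ 2 ≤ ‖hypOp g z‖ₑ ^ 2 := pow_le_pow_left₀ zero_le hz.le 2
        _ = ‖hypOp g z ^ 2‖ₑ := (enorm_pow _ _).symm
        _ ≤ ‖hypPairOp g (farSet u κ) z‖ₑ + ‖hypPairOp g (farSet u κ)ᶜ z‖ₑ := by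
            rw [hypOp_sq hi hfar]; exact enorm_add_le _ _
        _ ≤ _ := by
            gcongr
            exact (enorm_hypPairOp_le _ _ _).trans near
    have h2 := (ENNReal.add_le_add_iff_right ENNReal.ofReal_ne_top).1 h1
    have h3 := pow_le_pow_left₀ zero_le h2 2
    rw [← ENNReal.ofReal_pow (by positivity)] at h3
    show ENNReal.ofReal (l ^ 4 / 4) ≤ _
    rwa [show l ^ 4 / 4 = (l ^ 2 / 2) ^ 2 by ring]
  have hl4 : 0 < l ^ 4 / 4 := by positivity
  calc volume {z | ENNReal.ofReal l < ‖hypOp g z‖ₑ}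
      ≤ (∫⁻ z, ‖hypPairOp g (farSet u κ) z‖ₑ ^ 2) / ENNReal.ofReal (l ^ 4 / 4) :=
        (measure_mono hsub).trans (meas_ge_le_lintegral_div
          ((stronglyMeasurable_hypPairOp hg _).measurable.enorm.pow_const 2).aemeasurable
          (by simpa using hl4) ENNReal.ofReal_ne_top)
    _ ≤ K * (κ ^ (-a) * N) / ENNReal.ofReal (l ^ 4 / 4) := by
        rw [← hD]; exact ENNReal.div_le_div_right far _
    _ = K * ENNReal.ofReal (k ^ (-a) * (n / (l ^ 4 / 4))) := by
        rw [mul_div_assoc, mul_div_assoc, hNn, ENNReal.ofReal_rpow_of_pos hk,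
          ← ENNReal.ofReal_div_of_pos hl4, ← ENNReal.ofReal_mul (by positivity)]
    _ = _ := by
        rw [threshold_rpow_identity (by linarith) hap hl hn, ← hc,
          ENNReal.ofReal_mul (by positivity : 0 ≤ c), ENNReal.ofReal_mul (p := l ^ _)
          (by positivity), mul_assoc K, hNn, ENNReal.ofReal_rpow_of_pos hn]

/-! ### Interpolation with the trivial bound -/

theorem stronglyMeasurable_hypOp {g : ℝ × ℝ → ℂ} (hg : Measurable g) :
    StronglyMeasurable (hypOp g) := by
  unfold hypOp
  apply StronglyMeasurable.integral_prod_right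
    (f := fun z w => Complex.exp (Complex.I * (dot3 z (hypParam w) : ℝ)) * g w)
  apply Measurable.stronglyMeasurable
  unfold Function.uncurry
  fun_prop

/-- The condition on `l` says `l ≤ 2 γ^(-r)`, so this is the integral of a power over an interval.
After Fubini, with `γ = |g(w)|`, these are the levels at which the truncation keeps `w`. -/
theorem setLIntegral_threshold_le {γ r k : ℝ} (hγ : 0 < γ) (hr : 0 < r) (hk : 0 < k) :
    ∫⁻ l in Set.Ioi (0 : ℝ) ∩ {l | γ ≤ (l / 2) ^ (-(1 / r))}, ENNReal.ofReal ((l / 2) ^ (k - 1))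
      ≤ ENNReal.ofReal (2 / k * γ ^ (-(r * k))) := by
  set Λ : ℝ := 2 * γ ^ (-r) with hΛ
  have hΛ0 : 0 < Λ := by positivity
  have hsub : Set.Ioi (0 : ℝ) ∩ {l | γ ≤ (l / 2) ^ (-(1 / r))} ⊆ Set.Ioc 0 Λ := by
    rintro l ⟨h0, h1⟩
    have h0 : 0 < l := h0
    have h1 : γ ≤ (l / 2) ^ (-(1 / r)) := h1
    refine ⟨h0, ?_⟩
    have := Real.rpow_le_rpow_of_nonpos hγ h1 (by linarith : -r ≤ 0)
    rw [← Real.rpow_mul (by positivity), show -(1 / r) * -r = 1 by field_simp, Real.rpow_one]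
      at this
    linarith
  refine (lintegral_mono_set hsub).trans ?_
  have hint : IntervalIntegrable (fun l : ℝ => l ^ (k - 1)) volume 0 Λ :=
    intervalIntegral.intervalIntegrable_rpow' (by linarith)
  have e : ∀ l ∈ Set.Ioc 0 Λ, (l / 2) ^ (k - 1) = (2 : ℝ) ^ (1 - k) * l ^ (k - 1) := by
    intro l hl
    rw [Real.div_rpow hl.1.le (by norm_num), div_eq_mul_inv, ← Real.rpow_neg (by norm_num),
      neg_sub, mul_comm]
  rw [setLIntegral_congr_fun measurableSet_Ioc
    (fun l hl => by rw [e l hl] : Set.EqOn _ (fun l => ENNReal.ofReal ((2 : ℝ) ^ (1 - k)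
      * l ^ (k - 1))) _)]
  rw [← ofReal_integral_eq_lintegral_ofReal]
  · apply ENNReal.ofReal_le_ofReal
    rw [integral_const_mul, ← intervalIntegral.integral_of_le hΛ0.le,
      integral_rpow (Or.inl (by linarith)), sub_add_cancel, Real.zero_rpow hk.ne', sub_zero, hΛ,
      Real.mul_rpow (by norm_num) (by positivity), ← Real.rpow_mul hγ.le, neg_mul]
    have : (2 : ℝ) ^ (1 - k) * 2 ^ k = 2 := by
      rw [← Real.rpow_add (by norm_num)]; norm_num
    apply le_of_eq
    calc _ = ((2 : ℝ) ^ (1 - k) * 2 ^ k) * γ ^ (-(r * k)) / k := by ring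
      _ = _ := by rw [this]; ring
  · exact ((intervalIntegrable_iff_integrableOn_Ioc_of_le hΛ0.le).1 hint).const_mul _
  · filter_upwards [self_mem_ae_restrict measurableSet_Ioc] with l hl
    have := hl.1
    positivity

/-- The truncation of `g` to the set where `|g| ≤ h`. -/
noncomputable def truncAt (g : ℝ × ℝ → ℂ) (h : ℝ) : ℝ × ℝ → ℂ := {w | ‖g w‖ ≤ h}.indicator g

theorem measurableSet_norm_le {g : ℝ × ℝ → ℂ} (hg : Measurable g) (h : ℝ) :
    MeasurableSet {w | ‖g w‖ ≤ h} := measurableSet_le hg.norm measurable_const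

theorem lintegral_truncAt_le {g : ℝ × ℝ → ℂ} (hg : Measurable g) {p p₀ h : ℝ}
    (hp : 0 < p) (hpp : p ≤ p₀) (hh : 0 < h) :
    ∫⁻ w, ‖truncAt g h w‖ₑ ^ p₀ ≤ ENNReal.ofReal (h ^ (p₀ - p)) * ∫⁻ w, ‖g w‖ₑ ^ p := by
  rw [← lintegral_const_mul _ (by fun_prop)]
  refine lintegral_mono fun w => ?_
  unfold truncAt
  by_cases hw : w ∈ {w | ‖g w‖ ≤ h}
  · rw [Set.indicator_of_mem hw, show p₀ = (p₀ - p) + p by ring,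
      ENNReal.rpow_add_of_nonneg _ _ (by linarith) hp.le, add_sub_cancel_right]
    refine mul_le_mul_left ?_ _
    rw [← ENNReal.ofReal_rpow_of_pos hh]
    refine ENNReal.rpow_le_rpow ?_ (by linarith)
    rw [← ofReal_norm]
    exact ENNReal.ofReal_le_ofReal hw
  · rw [Set.indicator_of_notMem hw, enorm_zero, ENNReal.zero_rpow_of_pos (by linarith)]
    exact zero_le

/-- The discarded part is estimated in `L¹`: where `|g| > h`, one has `|g| ≤ h^(1 - p) |g|^p`. -/
theorem enorm_hypOp_le_truncAt {g : ℝ × ℝ → ℂ} (hg : Measurable g) (hi : Integrable g)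
    {p h : ℝ} (hp : 1 < p) (hh : 0 < h) (z : ℝ × ℝ × ℝ) :
    ‖hypOp g z‖ₑ
      ≤ ‖hypOp (truncAt g h) z‖ₑ + ENNReal.ofReal (h ^ (1 - p)) * ∫⁻ w, ‖g w‖ₑ ^ p := by
  have hS := measurableSet_norm_le hg h
  have e1 : hypOp g z = hypOp (truncAt g h) z + ∫ w in {w | ‖g w‖ ≤ h}ᶜ,
      Complex.exp (Complex.I * (dot3 z (hypParam w) : ℝ)) * g w := by
    unfold hypOp truncAt
    rw [← integral_add_compl hS (integrable_exp_mul hi (by fun_prop)), ← integral_indicator hS]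
    congr 1
    refine integral_congr_ae (Filter.Eventually.of_forall fun w => ?_)
    by_cases hw : w ∈ {w | ‖g w‖ ≤ h}
    · simp only [Set.indicator_of_mem hw]
    · simp only [Set.indicator_of_notMem hw, mul_zero]
  rw [e1]
  refine (enorm_add_le _ _).trans (add_le_add le_rfl
    ((enorm_integral_le_lintegral_enorm _).trans ?_))
  simp only [enorm_mul, enorm_exp_I_mul_ofReal, one_mul]
  rw [← lintegral_const_mul _ (by fun_prop)]
  refine le_trans (setLIntegral_mono (by fun_prop) fun w hw => ?_) (setLIntegral_le_lintegral _ _)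
  have hw : ¬ ‖g w‖ ≤ h := hw
  have hw : h < ‖g w‖ := not_le.1 hw
  have hw0 : 0 < ‖g w‖ := hh.trans hw
  rw [← ofReal_norm, ENNReal.ofReal_rpow_of_pos hw0, ← ENNReal.ofReal_mul (by positivity)]
  apply ENNReal.ofReal_le_ofReal
  calc ‖g w‖ = ‖g w‖ ^ (1 - p) * ‖g w‖ ^ p := by
        rw [← Real.rpow_add hw0]; simp
    _ ≤ _ := by
        refine mul_le_mul_of_nonneg_right ?_ (by positivity)
        exact Real.rpow_le_rpow_of_nonpos hh hw.le (by linarith)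

/-- Marcinkiewicz interpolation between the weak type at some `p₀ > p` and `L¹ → L^∞`. At level `l`
the function is cut at a height for which its large part contributes at most `l / 2` everywhere, so
only the small part enters the distribution function. -/
theorem hypOp_strong_type_normalized {p : ℝ} (hp : 1 < p) (hp4 : p < 4) :
    ∃ C : ℝ≥0∞, C ≠ ⊤ ∧ ∀ g : ℝ × ℝ → ℂ, Measurable g → Integrable g →
      ∫⁻ w, ‖g w‖ₑ ^ p = 1 → ∫⁻ z, ‖hypOp g z‖ₑ ^ (3 * p / (p - 1)) ≤ C := by
  obtain ⟨p₀, h20, hpp, h04⟩ : ∃ p₀ : ℝ, 2 ≤ p₀ ∧ p < p₀ ∧ p₀ < 4 := by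
    rcases le_total p 2 with h | h
    · exact ⟨3, by norm_num, by linarith, by norm_num⟩
    · exact ⟨(p + 4) / 2, by linarith, by linarith, by linarith⟩
  obtain ⟨C, hC, hweak⟩ := hypOp_weak_type h20 h04
  set q := 3 * p / (p - 1) with hq
  set q₀ := 3 * p₀ / (p₀ - 1) with hq₀
  have hp1 : 0 < p - 1 := by linarith
  have hp01 : 0 < p₀ - 1 := by linarith
  have hq0 : 0 < q := by positivity
  -- The weak-type bound carries the power `e + 1` of the truncated integral. The power `e` is
  -- bounded by the truncation height, and one factor is kept linear so that Fubini applies; `e > 0`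
  -- because `p₀ < 4`.
  set e := 3 / (p₀ - 1) - 1 with he
  have he0 : 0 < e := by rw [he, sub_pos, lt_div_iff₀ hp01]; linarith
  -- All powers of `l` in the layer-cake integral combine to `l^(k - 1)`, integrable at `0` since `k
  -- > 0`.
  set k := (p₀ - p) / (p - 1) with hk
  have hk0 : 0 < k := div_pos (by linarith) hp1
  set c : ℝ≥0∞ := ENNReal.ofReal q * (C * ENNReal.ofReal (2 ^ (q - 1)) * ENNReal.ofReal (2 / k))
  refine ⟨c, ?_, ?_⟩
  · exact ENNReal.mul_ne_top ENNReal.ofReal_ne_top (ENNReal.mul_ne_top (ENNReal.mul_ne_top hC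
      ENNReal.ofReal_ne_top) ENNReal.ofReal_ne_top)
  intro g hg hi hN
  have hTm := (stronglyMeasurable_hypOp hg).measurable
  -- The height solving `h^(1 - p) = l / 2`.
  set h : ℝ → ℝ := fun l => (l / 2) ^ (-(1 / (p - 1))) with hh
  set G : ℝ → ℝ × ℝ → ℝ≥0∞ := fun l w => {w | ‖g w‖ ≤ h l}.indicator (fun w => ‖g w‖ₑ ^ p₀) w
  have hGt : ∀ l w, ‖truncAt g (h l) w‖ₑ ^ p₀ = G l w := by
    intro l w
    unfold truncAt
    by_cases hw : w ∈ {w | ‖g w‖ ≤ h l}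
    · simp only [G, Set.indicator_of_mem hw]
    · simp only [G, Set.indicator_of_notMem hw, enorm_zero,
        ENNReal.zero_rpow_of_pos (by linarith : 0 < p₀)]
  have level : ∀ l ∈ Set.Ioi (0 : ℝ), volume {z | l < ‖hypOp g z‖} * ENNReal.ofReal (l ^ (q - 1))
      ≤ C * ENNReal.ofReal (2 ^ (q - 1)) * (ENNReal.ofReal ((l / 2) ^ (k - 1)) * ∫⁻ w, G l w) := by
    intro l hl
    have hl : 0 < l := hl
    have hl2 : 0 < l / 2 := by linarith
    have hhl : 0 < h l := by positivity
    have hA := lintegral_truncAt_le hg (by linarith : 0 < p) hpp.le hhl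
    rw [hN, mul_one] at hA
    have hsub : {z | l < ‖hypOp g z‖}
        ⊆ {z | ENNReal.ofReal (l / 2) < ‖hypOp (truncAt g (h l)) z‖ₑ} := by
      intro z hz
      have hz : l < ‖hypOp g z‖ := hz
      have h1 := enorm_hypOp_le_truncAt hg hi hp hhl z
      have h2 : h l ^ (1 - p) = l / 2 := by
        rw [hh]; simp only
        rw [← Real.rpow_mul hl2.le, show -(1 / (p - 1)) * (1 - p) = 1 by field_simp; ring,
          Real.rpow_one]
      rw [hN, mul_one, h2] at h1
      have h3 : ENNReal.ofReal (l / 2) + ENNReal.ofReal (l / 2) < ‖hypOp g z‖ₑ := by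
        rw [← ENNReal.ofReal_add hl2.le hl2.le, add_halves, ← ofReal_norm]
        exact (ENNReal.ofReal_lt_ofReal_iff (hl.trans hz)).2 hz
      exact (ENNReal.add_lt_add_iff_right ENNReal.ofReal_ne_top).1 (h3.trans_le h1)
    have hmeas : Measurable (truncAt g (h l)) := hg.indicator (measurableSet_norm_le hg _)
    have hint : Integrable (truncAt g (h l)) := hi.indicator (measurableSet_norm_le hg _)
    have hw := hweak _ hmeas hint (ne_top_of_le_ne_top ENNReal.ofReal_ne_top hA) (l / 2) hl2
    have hpow : (∫⁻ w, ‖truncAt g (h l) w‖ₑ ^ p₀) ^ (3 / (p₀ - 1))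
        ≤ ENNReal.ofReal (h l ^ ((p₀ - p) * e)) * ∫⁻ w, G l w := by
      rw [show 3 / (p₀ - 1) = e + 1 by rw [he]; ring,
        ENNReal.rpow_add_of_nonneg _ _ he0.le (by norm_num), ENNReal.rpow_one]
      simp only [hGt] at hA ⊢
      refine mul_le_mul_left ((ENNReal.rpow_le_rpow hA he0.le).trans (le_of_eq ?_)) _
      rw [ENNReal.ofReal_rpow_of_pos (by positivity), ← Real.rpow_mul hhl.le]
    refine (mul_le_mul_left ((measure_mono hsub).trans (hw.trans (mul_le_mul_right
      (mul_le_mul_right hpow _) _))) _).trans (le_of_eq ?_)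
    have hreal : (l / 2) ^ (-q₀) * h l ^ ((p₀ - p) * e) * l ^ (q - 1)
        = 2 ^ (q - 1) * (l / 2) ^ (k - 1) := by
      have : l ^ (q - 1) = 2 ^ (q - 1) * (l / 2) ^ (q - 1) := by
        rw [← Real.mul_rpow (by norm_num) hl2.le]; congr 1; ring
      rw [this, hh]; simp only
      rw [← Real.rpow_mul hl2.le]
      calc _ = 2 ^ (q - 1) * ((l / 2) ^ (-q₀) * (l / 2) ^ (-(1 / (p - 1)) * ((p₀ - p) * e))
            * (l / 2) ^ (q - 1)) := by ring
        _ = _ := by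
            rw [← Real.rpow_add hl2, ← Real.rpow_add hl2]
            congr 2
            rw [hk, he, hq, hq₀]
            field_simp
            ring
    calc _ = C * (ENNReal.ofReal ((l / 2) ^ (-q₀)) * ENNReal.ofReal (h l ^ ((p₀ - p) * e))
          * ENNReal.ofReal (l ^ (q - 1))) * ∫⁻ w, G l w := by ring
      _ = C * ENNReal.ofReal (2 ^ (q - 1) * (l / 2) ^ (k - 1)) * ∫⁻ w, G l w := by
          rw [← ENNReal.ofReal_mul (by positivity), ← ENNReal.ofReal_mul (by positivity), hreal]
      _ = _ := by
          rw [ENNReal.ofReal_mul (by positivity)]; ring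
  have hset : MeasurableSet {x : ℝ × (ℝ × ℝ) | ‖g x.2‖ ≤ h x.1} :=
    measurableSet_le (by fun_prop) (by fun_prop)
  have hGm : Measurable fun x : ℝ × (ℝ × ℝ) => G x.1 x.2 := by
    have : (fun x : ℝ × (ℝ × ℝ) => G x.1 x.2)
        = {x : ℝ × (ℝ × ℝ) | ‖g x.2‖ ≤ h x.1}.indicator (fun x => ‖g x.2‖ₑ ^ p₀) := rfl
    rw [this]
    exact Measurable.indicator (by fun_prop) hset
  have inner : ∀ w, ∫⁻ l in Set.Ioi (0 : ℝ), ENNReal.ofReal ((l / 2) ^ (k - 1)) * G l w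
      ≤ ENNReal.ofReal (2 / k) * ‖g w‖ₑ ^ p := by
    intro w
    rcases eq_or_ne (g w) 0 with h0 | h0
    · have : ∀ l, G l w = 0 := by
        intro l
        rw [← hGt]
        unfold truncAt
        simp [Set.indicator_apply, h0, ENNReal.zero_rpow_of_pos (by linarith : 0 < p₀)]
      simp [this]
    have hγ : 0 < ‖g w‖ := norm_pos_iff.2 h0
    have hm : MeasurableSet {l : ℝ | ‖g w‖ ≤ (l / 2) ^ (-(1 / (p - 1)))} :=
      measurableSet_le measurable_const (by fun_prop)
    have e1 : ∀ l, ENNReal.ofReal ((l / 2) ^ (k - 1)) * G l w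
        = {l : ℝ | ‖g w‖ ≤ (l / 2) ^ (-(1 / (p - 1)))}.indicator
          (fun l => ‖g w‖ₑ ^ p₀ * ENNReal.ofReal ((l / 2) ^ (k - 1))) l := by
      intro l
      by_cases hl : ‖g w‖ ≤ (l / 2) ^ (-(1 / (p - 1)))
      · have h2 : w ∈ {w | ‖g w‖ ≤ h l} := hl
        simp only [G]
        rw [Set.indicator_of_mem h2, Set.indicator_of_mem
          (show l ∈ {l : ℝ | ‖g w‖ ≤ (l / 2) ^ (-(1 / (p - 1)))} from hl), mul_comm]
      · have h2 : w ∉ {w | ‖g w‖ ≤ h l} := hl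
        simp only [G]
        rw [Set.indicator_of_notMem h2, Set.indicator_of_notMem
          (show l ∉ {l : ℝ | ‖g w‖ ≤ (l / 2) ^ (-(1 / (p - 1)))} from hl), mul_zero]
    simp_rw [e1]
    rw [setLIntegral_indicator hm, Set.inter_comm, lintegral_const_mul _ (by fun_prop)]
    refine (mul_le_mul_right (setLIntegral_threshold_le hγ hp1 hk0) _).trans (le_of_eq ?_)
    rw [← ofReal_norm, ENNReal.ofReal_rpow_of_pos hγ, ENNReal.ofReal_rpow_of_pos hγ,
      ← ENNReal.ofReal_mul (by positivity), ← ENNReal.ofReal_mul (by positivity)]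
    congr 1
    have : ‖g w‖ ^ p = ‖g w‖ ^ p₀ * ‖g w‖ ^ (-((p - 1) * k)) := by
      rw [← Real.rpow_add hγ]; congr 1; rw [hk]; field_simp; ring
    rw [this]; ring
  have cake : ∫⁻ z, ‖hypOp g z‖ₑ ^ q = ENNReal.ofReal q *
      ∫⁻ l in Set.Ioi (0 : ℝ), volume {z | l < ‖hypOp g z‖} * ENNReal.ofReal (l ^ (q - 1)) := by
    rw [← lintegral_rpow_eq_lintegral_meas_lt_mul volume
      (Filter.Eventually.of_forall fun z => norm_nonneg _) hTm.norm.aemeasurable hq0]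
    refine lintegral_congr fun z => ?_
    rw [← ofReal_norm, ENNReal.ofReal_rpow_of_nonneg (norm_nonneg _) hq0.le]
  rw [cake]
  refine mul_le_mul_right ?_ _
  calc _ ≤ ∫⁻ l in Set.Ioi (0 : ℝ), C * ENNReal.ofReal (2 ^ (q - 1))
        * (ENNReal.ofReal ((l / 2) ^ (k - 1)) * ∫⁻ w, G l w) :=
        setLIntegral_mono' measurableSet_Ioi level
    _ = C * ENNReal.ofReal (2 ^ (q - 1)) * ∫⁻ l in Set.Ioi (0 : ℝ), ∫⁻ w,
          ENNReal.ofReal ((l / 2) ^ (k - 1)) * G l w := by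
        rw [lintegral_const_mul' _ _ (ENNReal.mul_ne_top hC ENNReal.ofReal_ne_top)]
        congr 1
        refine lintegral_congr fun l => ?_
        rw [lintegral_const_mul' _ _ ENNReal.ofReal_ne_top]
    _ = C * ENNReal.ofReal (2 ^ (q - 1)) * ∫⁻ w, ∫⁻ l in Set.Ioi (0 : ℝ),
          ENNReal.ofReal ((l / 2) ^ (k - 1)) * G l w := by
        rw [lintegral_lintegral_swap]
        have : Measurable fun x : ℝ × (ℝ × ℝ) => ENNReal.ofReal ((x.1 / 2) ^ (k - 1)) * G x.1 x.2 :=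
          (by fun_prop : Measurable fun x : ℝ × (ℝ × ℝ) =>
            ENNReal.ofReal ((x.1 / 2) ^ (k - 1))).mul hGm
        exact this.aemeasurable
    _ ≤ C * ENNReal.ofReal (2 ^ (q - 1)) * ∫⁻ w, ENNReal.ofReal (2 / k) * ‖g w‖ₑ ^ p :=
        mul_le_mul_right (lintegral_mono inner) _
    _ = C * ENNReal.ofReal (2 ^ (q - 1)) * ENNReal.ofReal (2 / k) := by
        rw [lintegral_const_mul _ (by fun_prop), hN, mul_one]

/-- Both sides are homogeneous of degree `3p/(p - 1)` in `g`, so `g` may be normalized. -/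
theorem hypOp_strong_type {p : ℝ} (hp : 1 < p) (hp4 : p < 4) :
    ∃ C : ℝ≥0∞, C ≠ ⊤ ∧ ∀ g : ℝ × ℝ → ℂ, Measurable g → Integrable g → ∫⁻ w, ‖g w‖ₑ ^ p ≠ ⊤ →
      (∫⁻ z, ‖hypOp g z‖ₑ ^ (3 * p / (p - 1))) ≤ C * (∫⁻ w, ‖g w‖ₑ ^ p) ^ (3 / (p - 1)) := by
  obtain ⟨C, hC, hnorm⟩ := hypOp_strong_type_normalized hp hp4
  refine ⟨C, hC, fun g hg hi hN => ?_⟩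
  have hp0 : 0 < p := by linarith
  have hq0 : 0 < 3 * p / (p - 1) := by positivity
  set N := ∫⁻ w, ‖g w‖ₑ ^ p with hN_def
  rcases eq_or_ne N 0 with h0 | h0
  · simp [hypOp_eq_zero_of_lintegral_eq_zero hg hp0 h0, ENNReal.zero_rpow_of_pos hq0]
  set n := N.toReal
  have hn : 0 < n := ENNReal.toReal_pos h0 hN
  have hNn : N = ENNReal.ofReal n := (ENNReal.ofReal_toReal hN).symm
  set c : ℝ := n ^ (-(1 / p)) with hc
  have hc0 : 0 < c := by positivity
  have hce : ‖(c : ℂ)‖ₑ = ENNReal.ofReal c := by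
    rw [← ofReal_norm, Complex.norm_real, Real.norm_eq_abs, abs_of_pos hc0]
  have h1 : ∫⁻ w, ‖(c : ℂ) * g w‖ₑ ^ p = 1 := by
    simp only [enorm_mul, ENNReal.mul_rpow_of_nonneg _ _ hp0.le]
    rw [lintegral_const_mul _ (by fun_prop), ← hN_def, hNn, hce, ENNReal.ofReal_rpow_of_pos hc0,
      ← ENNReal.ofReal_mul (by positivity), hc, ← Real.rpow_mul hn.le,
      show -(1 / p) * p = -1 by field_simp, Real.rpow_neg_one, inv_mul_cancel₀ hn.ne',
      ENNReal.ofReal_one]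
  have h2 := hnorm (fun w => (c : ℂ) * g w) (by fun_prop) (hi.const_mul _) h1
  have h3 : ∀ z, hypOp (fun w => (c : ℂ) * g w) z = c * hypOp g z := by
    intro z
    unfold hypOp
    rw [← integral_const_mul]
    refine integral_congr_ae (Filter.Eventually.of_forall fun w => ?_)
    simp only; ring
  simp only [h3, enorm_mul, ENNReal.mul_rpow_of_nonneg _ _ hq0.le, hce] at h2
  rw [lintegral_const_mul _ ((stronglyMeasurable_hypOp hg).measurable.enorm.pow_const _)] at h2
  have h4 : N ^ (3 / (p - 1)) * ENNReal.ofReal c ^ (3 * p / (p - 1)) = 1 := by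
    rw [hNn, ENNReal.ofReal_rpow_of_pos hn, ENNReal.ofReal_rpow_of_pos hc0,
      ← ENNReal.ofReal_mul (by positivity), hc, ← Real.rpow_mul hn.le, ← Real.rpow_add hn,
      show 3 / (p - 1) + -(1 / p) * (3 * p / (p - 1)) = 0 by field_simp; ring, Real.rpow_zero,
      ENNReal.ofReal_one]
  calc _ = N ^ (3 / (p - 1)) * (ENNReal.ofReal c ^ (3 * p / (p - 1))
        * ∫⁻ z, ‖hypOp g z‖ₑ ^ (3 * p / (p - 1))) := by rw [← mul_assoc, h4, one_mul]
    _ ≤ N ^ (3 / (p - 1)) * C := mul_le_mul_right h2 _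
    _ = _ := mul_comm _ _

/-! ### The invariant measure in hyperbolic coordinates -/

theorem lintegral_sinh_subst {m : ℝ} (hm : 0 < m) (k : ℝ → ℝ → ℝ≥0∞) :
    ∫⁻ y, ENNReal.ofReal (1 / √(y ^ 2 + m ^ 2)) * k √(y ^ 2 + m ^ 2) y
      = ∫⁻ s, k (m * Real.cosh s) (m * Real.sinh s) := by
  have himg : (fun s => m * Real.sinh s) '' Set.univ = Set.univ := by
    rw [Set.image_univ, Set.range_eq_univ]
    intro y
    obtain ⟨s, hs⟩ := Real.sinh_surjective (y / m)
    exact ⟨s, by simp only; rw [hs]; field_simp⟩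
  have hinj : Set.InjOn (fun s => m * Real.sinh s) Set.univ := fun a _ b _ h =>
    Real.sinh_injective (mul_left_cancel₀ hm.ne' h)
  rw [← setLIntegral_univ, ← himg, lintegral_image_eq_lintegral_abs_deriv_mul MeasurableSet.univ
    (fun s _ => ((Real.hasDerivAt_sinh s).const_mul m).hasDerivWithinAt) hinj, setLIntegral_univ]
  refine lintegral_congr fun s => ?_
  have hc := mul_pos hm (Real.cosh_pos s)
  have e : (m * Real.sinh s) ^ 2 + m ^ 2 = (m * Real.cosh s) ^ 2 := by
    rw [mul_pow, mul_pow, Real.cosh_sq]; ring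
  rw [e, Real.sqrt_sq hc.le, abs_of_pos hc, ← mul_assoc, ← ENNReal.ofReal_mul hc.le,
    mul_one_div_cancel hc.ne', ENNReal.ofReal_one, one_mul]

/-- Substitute `y = e m cosh s` on `s > 0`. The two values `±√(y² - m²)` correspond to `±s`, so the
sum over them fills the whole line and cancels the density. -/
theorem lintegral_cosh_subst {m e : ℝ} (hm : 0 < m) (he : e ^ 2 = 1) {k : ℝ → ℝ → ℝ≥0∞}
    (hk : Measurable (Function.uncurry k)) :
    ∫⁻ y in {y | m < e * y}, ENNReal.ofReal (1 / √(y ^ 2 - m ^ 2))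
        * (k (-√(y ^ 2 - m ^ 2)) y + k √(y ^ 2 - m ^ 2) y)
      = ∫⁻ s, k (m * Real.sinh s) (e * (m * Real.cosh s)) := by
  have he1 : |e| = 1 := by rw [← sq_eq_sq₀ (abs_nonneg _) zero_le_one, sq_abs, he, one_pow]
  have he0 : e ≠ 0 := by rintro rfl; norm_num at he
  have himg : (fun s => e * (m * Real.cosh s)) '' Set.Ioi 0 = {y | m < e * y} := by
    ext y
    simp only [Set.mem_image, Set.mem_Ioi, Set.mem_ofPred_eq]
    constructor
    · rintro ⟨s, hs, rfl⟩
      have : 1 < Real.cosh s := Real.one_lt_cosh.2 hs.ne'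
      calc m < m * Real.cosh s := by nlinarith
        _ = e * (e * (m * Real.cosh s)) := by rw [← mul_assoc, ← sq, he, one_mul]
    · intro hy
      have h1 : 1 < e * y / m := by rwa [lt_div_iff₀ hm, one_mul]
      refine ⟨Real.arcosh (e * y / m), Real.arcosh_pos h1, ?_⟩
      rw [Real.cosh_arcosh h1.le]
      field_simp
      linear_combination y * he
  have hinj : Set.InjOn (fun s => e * (m * Real.cosh s)) (Set.Ioi 0) := by
    intro a ha b hb h
    have h2 : Real.cosh a = Real.cosh b := mul_left_cancel₀ hm.ne' (mul_left_cancel₀ he0 h)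
    have := Real.cosh_abs a ▸ Real.cosh_abs b ▸ h2
    have h3 : |a| = |b| := le_antisymm (Real.cosh_le_cosh.1 h2.le) (Real.cosh_le_cosh.1 h2.ge)
    rwa [abs_of_pos ha, abs_of_pos hb] at h3
  rw [← himg, lintegral_image_eq_lintegral_abs_deriv_mul measurableSet_Ioi
    (fun s _ => (((Real.hasDerivAt_cosh s).const_mul m).const_mul e).hasDerivWithinAt) hinj]
  have e1 : ∫⁻ s in Set.Ioi (0 : ℝ), ENNReal.ofReal |e * (m * Real.sinh s)|
        * (ENNReal.ofReal (1 / √((e * (m * Real.cosh s)) ^ 2 - m ^ 2))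
          * (k (-√((e * (m * Real.cosh s)) ^ 2 - m ^ 2)) (e * (m * Real.cosh s))
            + k √((e * (m * Real.cosh s)) ^ 2 - m ^ 2) (e * (m * Real.cosh s))))
      = ∫⁻ s in Set.Ioi (0 : ℝ), (k (m * Real.sinh (-s)) (e * (m * Real.cosh (-s)))
          + k (m * Real.sinh s) (e * (m * Real.cosh s))) := by
    refine setLIntegral_congr_fun measurableSet_Ioi fun s hs => ?_
    have hc := mul_pos hm (Real.sinh_pos_iff.2 hs)
    have e : (e * (m * Real.cosh s)) ^ 2 - m ^ 2 = (m * Real.sinh s) ^ 2 := by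
      rw [mul_pow, he, mul_pow, mul_pow, Real.cosh_sq]; ring
    rw [e, Real.sqrt_sq hc.le, abs_mul, he1, one_mul, abs_of_pos hc, ← mul_assoc,
      ← ENNReal.ofReal_mul hc.le, mul_one_div_cancel hc.ne', ENNReal.ofReal_one, one_mul,
      Real.sinh_neg, Real.cosh_neg, mul_neg]
  set κ : ℝ → ℝ≥0∞ := fun s => k (m * Real.sinh s) (e * (m * Real.cosh s)) with hκ
  have hκm : Measurable κ :=
    hk.comp (by fun_prop : Measurable fun s => (m * Real.sinh s, e * (m * Real.cosh s)))
  have e2 : ∫⁻ s in Set.Ioi (0 : ℝ), κ (-s) = ∫⁻ s in Set.Iio (0 : ℝ), κ s := by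
    have := (Measure.measurePreserving_neg (volume : Measure ℝ)).setLIntegral_comp_preimage
      (measurableSet_Iio (a := (0 : ℝ))) hκm
    rw [← this]
    congr 2
    ext x; simp
  refine e1.trans ?_
  have e3 : ∫⁻ s in Set.Ioi (0 : ℝ), (κ (-s) + κ s) = ∫⁻ s, κ s := by
    have hκn : Measurable fun s => κ (-s) := hκm.comp measurable_neg
    rw [lintegral_add_left hκn, e2, restrict_Iio_eq_restrict_Iic,
      ← lintegral_add_compl (μ := volume) κ (measurableSet_Iic (a := (0 : ℝ))), Set.compl_Iic]
  exact e3

/-- The four pieces of the hyperboloid: `c` tells whether `|ξ₁| > 1`, and `e = ±1`. -/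
noncomputable def hypPiece (c : Bool) (e : ℝ) (w : ℝ × ℝ) : SpaceTime :=
  bif c then (e * (√|w.1 ^ 2 - 1| * Real.cosh w.2), !₂[w.1, √|w.1 ^ 2 - 1| * Real.sinh w.2])
  else (√|w.1 ^ 2 - 1| * Real.sinh w.2, !₂[w.1, e * (√|w.1 ^ 2 - 1| * Real.cosh w.2)])

/-- The range of the parameters of `hypPiece`. -/
def hypDomain (c : Bool) : Set (ℝ × ℝ) := bif c then {w | 1 < w.1 ^ 2} else {w | w.1 ^ 2 < 1}

theorem measurableSet_hypDomain (c : Bool) : MeasurableSet (hypDomain c) := by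
  cases c
  · exact measurableSet_lt (by fun_prop) measurable_const
  · exact measurableSet_lt measurable_const (by fun_prop)

theorem measurable_euclideanPair : Measurable fun p : ℝ × ℝ =>
    (!₂[p.1, p.2] : EuclideanSpace ℝ (Fin 2)) :=
  (EuclideanSpace.volume_preserving_symm_measurableEquiv_toLp (Fin 2)).symm.measurable.comp
    (volume_preserving_finTwoArrow ℝ).symm.measurable

theorem measurePreserving_euclideanPair :
    MeasurePreserving fun p : ℝ × ℝ => (!₂[p.1, p.2] : EuclideanSpace ℝ (Fin 2)) :=
  (EuclideanSpace.volume_preserving_symm_measurableEquiv_toLp (Fin 2)).symm.comp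
    (volume_preserving_finTwoArrow ℝ).symm

theorem measurable_hypPiece (c : Bool) (e : ℝ) : Measurable (hypPiece c e) := by
  cases c
  · exact (by fun_prop : Measurable fun w : ℝ × ℝ => √|w.1 ^ 2 - 1| * Real.sinh w.2).prodMk
      (measurable_euclideanPair.comp (by fun_prop : Measurable fun w : ℝ × ℝ =>
        (w.1, e * (√|w.1 ^ 2 - 1| * Real.cosh w.2))))
  · exact (by fun_prop : Measurable fun w : ℝ × ℝ => e * (√|w.1 ^ 2 - 1| * Real.cosh w.2)).prodMk
      (measurable_euclideanPair.comp (by fun_prop : Measurable fun w : ℝ × ℝ =>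
        (w.1, √|w.1 ^ 2 - 1| * Real.sinh w.2)))

/-- The measure carried by a piece of the hyperboloid. -/
noncomputable def hypPieceMeasure (c : Bool) (e : ℝ) : Measure SpaceTime :=
  (volume.restrict (hypDomain c)).map (hypPiece c e)

theorem lintegral_hypPieceMeasure (c : Bool) (e : ℝ) {F : SpaceTime → ℝ≥0∞} (hF : Measurable F) :
    ∫⁻ ζ, F ζ ∂hypPieceMeasure c e
      = ∫⁻ x, ∫⁻ s, (hypDomain c).indicator (fun w => F (hypPiece c e w)) (x, s) := by
  have hm := measurable_hypPiece c e
  have hFm : Measurable fun w => F (hypPiece c e w) := hF.comp hm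
  rw [hypPieceMeasure, lintegral_map hF hm, ← lintegral_indicator (measurableSet_hypDomain c),
    ← lintegral_lintegral_reorder (hFm.indicator (measurableSet_hypDomain c))]

theorem measurable_hypBracket : Measurable hypBracket := by
  unfold hypBracket; fun_prop

theorem norm_euclideanPair_sq (x y : ℝ) :
    ‖(!₂[x, y] : EuclideanSpace ℝ (Fin 2))‖ ^ 2 = x ^ 2 + y ^ 2 := by
  rw [EuclideanSpace.norm_sq_eq]; simp

theorem lintegral_hypPlaneMeasure {H : EuclideanSpace ℝ (Fin 2) → ℝ≥0∞} (hH : Measurable H) :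
    ∫⁻ ξ, H ξ ∂hypPlaneMeasure = ∫⁻ x, ∫⁻ y, {p : ℝ × ℝ | 1 < p.1 ^ 2 + p.2 ^ 2}.indicator
      (fun p => ENNReal.ofReal (1 / √(p.1 ^ 2 + p.2 ^ 2 - 1)) * H !₂[p.1, p.2]) (x, y) := by
  have hb := measurable_hypBracket
  have hd : Measurable fun ξ => ENNReal.ofReal (1 / hypBracket ξ) := by fun_prop
  have hS : MeasurableSet {ξ : EuclideanSpace ℝ (Fin 2) | 1 < ‖ξ‖} :=
    measurableSet_lt measurable_const measurable_norm
  have hmp := measurePreserving_euclideanPair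
  have hm2 := measurable_euclideanPair
  have hcm : Measurable fun p : ℝ × ℝ => {ξ : EuclideanSpace ℝ (Fin 2) | 1 < ‖ξ‖}.indicator
      ((fun ξ => ENNReal.ofReal (1 / hypBracket ξ)) * H) !₂[p.1, p.2] :=
    ((hd.mul hH).indicator hS).comp hm2
  rw [hypPlaneMeasure, lintegral_withDensity_eq_lintegral_mul _ hd hH, ← lintegral_indicator hS,
    ← hmp.lintegral_comp ((hd.mul hH).indicator hS),
    lintegral_lintegral_reorder hcm]
  refine lintegral_congr fun x => lintegral_congr fun y => ?_
  have hiff : (1 < ‖(!₂[x, y] : EuclideanSpace ℝ (Fin 2))‖) ↔ 1 < x ^ 2 + y ^ 2 := by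
    rw [← norm_euclideanPair_sq, one_lt_sq_iff₀ (norm_nonneg _)]
  by_cases h : 1 < x ^ 2 + y ^ 2
  · rw [Set.indicator_of_mem (show (x, y) ∈ {p : ℝ × ℝ | 1 < p.1 ^ 2 + p.2 ^ 2} from h)]
    rw [Set.indicator_of_mem (show !₂[x, y] ∈ {ξ : EuclideanSpace ℝ (Fin 2) | 1 < ‖ξ‖} from
      hiff.2 h)]
    simp only [Pi.mul_apply, hypBracket, norm_euclideanPair_sq]
  · rw [Set.indicator_of_notMem (show (x, y) ∉ {p : ℝ × ℝ | 1 < p.1 ^ 2 + p.2 ^ 2} from h)]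
    rw [Set.indicator_of_notMem (show !₂[x, y] ∉ {ξ : EuclideanSpace ℝ (Fin 2) | 1 < ‖ξ‖} from
      fun h' => h (hiff.1 h'))]

/-- The invariant measure in the hyperbolic coordinates `(ξ₁, s)`. -/
theorem hypMeasure_eq_sum : hypMeasure = (hypPieceMeasure true (-1) + hypPieceMeasure true 1)
    + (hypPieceMeasure false 1 + hypPieceMeasure false (-1)) := by
  refine Measure.ext_of_lintegral _ fun F hF => ?_
  have hb := measurable_hypBracket
  have h1 : Measurable fun ξ => ((-hypBracket ξ, ξ) : SpaceTime) := hb.neg.prodMk measurable_id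
  have h2 : Measurable fun ξ => ((hypBracket ξ, ξ) : SpaceTime) := hb.prodMk measurable_id
  have h1F : Measurable fun ξ => F (-hypBracket ξ, ξ) := hF.comp h1
  have h2F : Measurable fun ξ => F (hypBracket ξ, ξ) := hF.comp h2
  have h12F : Measurable fun ξ => F (-hypBracket ξ, ξ) + F (hypBracket ξ, ξ) := h1F.add h2F
  have hind : ∀ c e, Measurable ((hypDomain c).indicator fun w => F (hypPiece c e w)) := fun c e =>
    (hF.comp (measurable_hypPiece c e)).indicator (measurableSet_hypDomain c)
  have hind' : ∀ c e, Measurable fun x : ℝ => ∫⁻ s, (hypDomain c).indicator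
      (fun w => F (hypPiece c e w)) (x, s) := fun c e => (hind c e).lintegral_prod_right'
  have h34 : Measurable fun x : ℝ => (∫⁻ s, (hypDomain true).indicator
      (fun w => F (hypPiece true (-1) w)) (x, s)) + ∫⁻ s, (hypDomain true).indicator
      (fun w => F (hypPiece true 1 w)) (x, s) := (hind' _ _).add (hind' _ _)
  simp only [lintegral_add_measure, lintegral_hypPieceMeasure _ _ hF]
  rw [hypMeasure, lintegral_add_measure, lintegral_map hF h1, lintegral_map hF h2,
    ← lintegral_add_left h1F, lintegral_hypPlaneMeasure h12F,
    ← lintegral_add_left (hind' _ _), ← lintegral_add_left (hind' _ _),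
    ← lintegral_add_left h34]
  have hone : ∀ᵐ x : ℝ, x ^ 2 ≠ 1 := by
    have h1 : ∀ᵐ ξ : ℝ, ξ ≠ 1 := by simp [ae_iff]
    have h2 : ∀ᵐ ξ : ℝ, ξ ≠ -1 := by simp [ae_iff]
    filter_upwards [h1, h2] with ξ h1 h2 h
    rcases sq_eq_one_iff.1 h with h | h
    all_goals tauto
  refine lintegral_congr_ae ?_
  filter_upwards [hone] with x hx
  set m := √|x ^ 2 - 1| with hm_def
  have hm : 0 < m := Real.sqrt_pos.2 (abs_pos.2 (sub_ne_zero.2 hx))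
  have hm2 : m ^ 2 = |x ^ 2 - 1| := Real.sq_sqrt (abs_nonneg _)
  set k : ℝ → ℝ → ℝ≥0∞ := fun t y => F (t, !₂[x, y]) with hk_def
  have hk : Measurable (Function.uncurry k) := by
    have : Measurable fun p : ℝ × ℝ => ((p.1, !₂[x, p.2]) : SpaceTime) :=
      measurable_fst.prodMk (measurable_euclideanPair.comp
        (by fun_prop : Measurable fun p : ℝ × ℝ => (x, p.2)))
    exact hF.comp this
  have hLHS : ∀ y, {p : ℝ × ℝ | 1 < p.1 ^ 2 + p.2 ^ 2}.indicator
      (fun p => ENNReal.ofReal (1 / √(p.1 ^ 2 + p.2 ^ 2 - 1)) *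
        (F (-hypBracket !₂[p.1, p.2], !₂[p.1, p.2]) + F (hypBracket !₂[p.1, p.2], !₂[p.1, p.2])))
            (x, y)
      = {y : ℝ | 1 < x ^ 2 + y ^ 2}.indicator (fun y => ENNReal.ofReal (1 / √(x ^ 2 + y ^ 2 - 1))
        * (k (-√(x ^ 2 + y ^ 2 - 1)) y + k √(x ^ 2 + y ^ 2 - 1) y)) y := by
    intro y
    simp only [Set.indicator_apply, Set.mem_ofPred_eq,
      hypBracket, norm_euclideanPair_sq, hk_def]
  simp_rw [hLHS]
  -- If `|x| < 1`, the range of `y` is `|y| > m`: the branches are told apart by the sign of `y`,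
  -- and each contains both signs of `τ`. If `|x| > 1`, every `y` occurs and the branches are told
  -- apart by the sign of `τ`.
  rcases lt_or_gt_of_ne hx with hlt | hgt
  · have hmem : ∀ s, (x, s) ∈ hypDomain false := fun s => hlt
    have hnot : ∀ s, (x, s) ∉ hypDomain true := fun s h => (lt_asymm hlt h : False)
    have hmm : m ^ 2 = 1 - x ^ 2 := by rw [hm2, abs_of_neg (by linarith)]; ring
    simp only [Set.indicator_of_mem (hmem _), Set.indicator_of_notMem (hnot _), lintegral_zero,
      zero_add]
    have hset : {y : ℝ | 1 < x ^ 2 + y ^ 2} = {y | m < 1 * y} ∪ {y | m < -1 * y} := by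
      ext y
      simp only [Set.mem_ofPred_eq, Set.mem_union, one_mul, neg_mul]
      rw [← lt_abs, ← sq_lt_sq₀ hm.le (abs_nonneg _), sq_abs, hmm]
      constructor <;> intro h <;> linarith
    have hdisj : Disjoint {y : ℝ | m < 1 * y} {y | m < -1 * y} := by
      rw [Set.disjoint_left]
      intro y h1 h2
      have h1 : m < 1 * y := h1
      have h2 : m < -1 * y := h2
      linarith
    have hms : ∀ e : ℝ, MeasurableSet {y : ℝ | m < e * y} := fun e =>
      measurableSet_lt measurable_const (by fun_prop)
    have hcongr : ∀ y : ℝ, x ^ 2 + y ^ 2 - 1 = y ^ 2 - m ^ 2 := fun y => by rw [hmm]; ring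
    simp_rw [hcongr]
    rw [lintegral_indicator (by rw [hset]; exact (hms 1).union (hms (-1))), hset,
      lintegral_union (hms (-1)) hdisj, lintegral_cosh_subst hm (by norm_num) hk,
      lintegral_cosh_subst hm (by norm_num) hk]
    rfl
  · have hmem : ∀ s, (x, s) ∈ hypDomain true := fun s => hgt
    have hnot : ∀ s, (x, s) ∉ hypDomain false := fun s h => (lt_asymm hgt h : False)
    have hmm : m ^ 2 = x ^ 2 - 1 := by rw [hm2, abs_of_pos (by linarith)]
    simp only [Set.indicator_of_mem (hmem _), Set.indicator_of_notMem (hnot _), lintegral_zero,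
      add_zero]
    have hset : {y : ℝ | 1 < x ^ 2 + y ^ 2} = Set.univ := by
      ext y
      simp only [Set.mem_ofPred_eq, Set.mem_univ, iff_true]
      nlinarith [sq_nonneg y]
    have hcongr : ∀ y : ℝ, x ^ 2 + y ^ 2 - 1 = y ^ 2 + m ^ 2 := fun y => by rw [hmm]; ring
    simp_rw [hcongr]
    rw [hset, Set.indicator_univ, lintegral_sinh_subst hm (fun b y => k (-b) y + k b y),
      lintegral_add_left]
    · simp only [hk_def, hypPiece, cond_true, one_mul, neg_mul, ← hm_def]
    · exact hk.comp (by fun_prop : Measurable fun s => (-(m * Real.cosh s), m * Real.sinh s))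

theorem hypPiece_mem_hyperboloid {c : Bool} {e : ℝ} (he : e ^ 2 = 1) {w : ℝ × ℝ}
    (hw : w ∈ hypDomain c) : hypPiece c e w ∈ hyperboloid := by
  have hm2 : √|w.1 ^ 2 - 1| ^ 2 = |w.1 ^ 2 - 1| := Real.sq_sqrt (abs_nonneg _)
  cases c
  · have hw : w.1 ^ 2 < 1 := hw
    show 1 + (√|w.1 ^ 2 - 1| * Real.sinh w.2) ^ 2
      = ‖(!₂[w.1, e * (√|w.1 ^ 2 - 1| * Real.cosh w.2)] : EuclideanSpace ℝ (Fin 2))‖ ^ 2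
    rw [norm_euclideanPair_sq, mul_pow, mul_pow, mul_pow, he, hm2, abs_of_neg (by linarith),
      Real.cosh_sq]
    ring
  · have hw : 1 < w.1 ^ 2 := hw
    show 1 + (e * (√|w.1 ^ 2 - 1| * Real.cosh w.2)) ^ 2
      = ‖(!₂[w.1, √|w.1 ^ 2 - 1| * Real.sinh w.2] : EuclideanSpace ℝ (Fin 2))‖ ^ 2
    rw [norm_euclideanPair_sq, mul_pow, mul_pow, mul_pow, he, hm2, abs_of_pos (by linarith),
      Real.cosh_sq]
    ring

theorem measurableSet_hyperboloid : MeasurableSet hyperboloid := by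
  have : Measurable fun ζ : SpaceTime => 1 + ζ.1 ^ 2 := by fun_prop
  exact measurableSet_eq_fun this (by fun_prop)

theorem ae_hypPieceMeasure_mem_hyperboloid (c : Bool) {e : ℝ} (he : e ^ 2 = 1) :
    ∀ᵐ ζ ∂hypPieceMeasure c e, ζ ∈ hyperboloid := by
  refine (ae_map_iff (p := fun ζ => ζ ∈ hyperboloid) (measurable_hypPiece c e).aemeasurable
    measurableSet_hyperboloid).2 ?_
  exact (ae_restrict_mem (measurableSet_hypDomain c)).mono fun w hw =>
    hypPiece_mem_hyperboloid he hw

theorem hypMeasure_restrict_hyperboloid : hypMeasure.restrict hyperboloid = hypMeasure := by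
  apply Measure.restrict_eq_self_of_ae_mem
  rw [hypMeasure_eq_sum]
  simp only [ae_add_measure_iff]
  exact ⟨⟨ae_hypPieceMeasure_mem_hyperboloid _ (by norm_num),
    ae_hypPieceMeasure_mem_hyperboloid _ (by norm_num)⟩,
    ae_hypPieceMeasure_mem_hyperboloid _ (by norm_num),
    ae_hypPieceMeasure_mem_hyperboloid _ (by norm_num)⟩

/-! ### Local finiteness of the invariant measure -/

/-- The function is the nonnegative derivative of `√(r² - 1)`, which is continuous up to `r = 1`. It
is the radial form of the density in polar coordinates. -/
theorem integrableOn_div_sqrt_sq_sub_one (R : ℝ) :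
    IntegrableOn (fun r : ℝ => r / √(r ^ 2 - 1)) (Set.Ioc 1 R) := by
  refine intervalIntegral.integrableOn_deriv_of_nonneg (g := fun r => √(r ^ 2 - 1))
    (by fun_prop) (fun r hr => ?_) fun r hr => ?_
  · have h0 : r ^ 2 - 1 ≠ 0 := by nlinarith [hr.1]
    convert (((hasDerivAt_pow 2 r).sub_const 1).sqrt h0) using 1
    field_simp
    simp [mul_comm]
  · have := hr.1
    positivity

theorem hypPlaneMeasure_closedBall_lt_top (R : ℝ) :
    hypPlaneMeasure (Metric.closedBall 0 R) < ⊤ := by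
  have hS : MeasurableSet {ξ : EuclideanSpace ℝ (Fin 2) | 1 < ‖ξ‖} :=
    measurableSet_lt measurable_const measurable_norm
  set φ : ℝ → ℝ := (Set.Ioc 1 R).indicator fun r => 1 / √(r ^ 2 - 1) with hφ
  have hint : Integrable fun ξ : EuclideanSpace ℝ (Fin 2) => φ ‖ξ‖ := by
    rw [integrable_fun_norm_addHaar]
    have : (fun y : ℝ => y ^ (Module.finrank ℝ (EuclideanSpace ℝ (Fin 2)) - 1) • φ y)
        = (Set.Ioc 1 R).indicator fun r : ℝ => r / √(r ^ 2 - 1) := by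
      ext y
      by_cases h : y ∈ Set.Ioc 1 R
      · simp [hφ, h, div_eq_mul_inv]
      · simp [hφ, h]
    rw [this]
    exact ((integrableOn_div_sqrt_sq_sub_one R).integrable_indicator
      measurableSet_Ioc).integrableOn
  refine lt_of_le_of_lt ?_ hint.2
  rw [hypPlaneMeasure, withDensity_apply _ Metric.isClosed_closedBall.measurableSet,
    Measure.restrict_restrict Metric.isClosed_closedBall.measurableSet,
    ← lintegral_indicator (Metric.isClosed_closedBall.measurableSet.inter hS)]
  refine lintegral_mono (Set.indicator_le' (g := fun ξ => ‖φ ‖ξ‖‖ₑ) (fun ξ hξ => ?_)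
    (fun _ _ => zero_le))
  have hmem : ‖ξ‖ ∈ Set.Ioc 1 R := ⟨hξ.2, mem_closedBall_zero_iff.1 hξ.1⟩
  rw [hφ, Set.indicator_of_mem hmem, hypBracket, Real.enorm_eq_ofReal (by positivity)]

/-- Makes continuous compactly supported functions integrable and `L^p` on `Γ`, as the splitting
into pieces requires. -/
instance : IsFiniteMeasureOnCompacts hypMeasure where
  lt_top_of_isCompact K hK := by
    obtain ⟨R, hR⟩ := hK.isBounded.subset_closedBall 0
    have h : ∀ s : EuclideanSpace ℝ (Fin 2) → ℝ, Measurable s →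
        hypPlaneMeasure.map (fun ξ => ((s ξ, ξ) : SpaceTime)) K < ⊤ := by
      intro s hs
      have hm : Measurable fun ξ => ((s ξ, ξ) : SpaceTime) := hs.prodMk measurable_id
      rw [Measure.map_apply hm hK.measurableSet]
      refine (measure_mono fun ξ hξ => ?_).trans_lt (hypPlaneMeasure_closedBall_lt_top R)
      have := mem_closedBall_zero_iff.1 (hR hξ)
      exact mem_closedBall_zero_iff.2 ((le_max_right _ _).trans this)
    rw [hypMeasure, Measure.add_apply]
    exact ENNReal.add_lt_top.2 ⟨h _ measurable_hypBracket.neg, h _ measurable_hypBracket⟩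

/-! ### From the pieces to the extension operator -/

/-- The linear change of the physical variables that reduces `hypPiece c e` to `hypParam`. -/
def hypPieceDual (c : Bool) (e : ℝ) (z : SpaceTime) : ℝ × ℝ × ℝ :=
  bif c then (z.2 0, e * z.1, z.2 1) else (z.2 0, e * z.2 1, z.1)

theorem phase_hypPiece (c : Bool) (e : ℝ) (z : SpaceTime) (w : ℝ × ℝ) :
    z.1 * (hypPiece c e w).1 + inner ℝ z.2 (hypPiece c e w).2
      = dot3 (hypPieceDual c e z) (hypParam w) := by
  cases c <;>
  simp [hypPiece, hypPieceDual, dot3, hypParam, PiLp.inner_apply, Fin.sum_univ_two] <;> ring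

theorem measurePreserving_const_mul {e : ℝ} (he : e ^ 2 = 1) :
    MeasurePreserving fun x : ℝ => e * x := by
  rcases sq_eq_one_iff.1 he with rfl | rfl
  · simp only [one_mul]
    exact MeasurePreserving.id volume
  · simp only [neg_mul, one_mul]
    exact Measure.measurePreserving_neg volume

theorem measurePreserving_hypPieceDual (c : Bool) {e : ℝ} (he : e ^ 2 = 1) :
    MeasurePreserving (hypPieceDual c e) := by
  have hP : MeasurePreserving fun x : EuclideanSpace ℝ (Fin 2) => (x 0, x 1) :=
    (volume_preserving_finTwoArrow ℝ).comp
      (EuclideanSpace.volume_preserving_symm_measurableEquiv_toLp (Fin 2))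
  have hid : MeasurePreserving (id : ℝ → ℝ) := MeasurePreserving.id volume
  have hswap : MeasurePreserving (Prod.swap : ℝ × ℝ → ℝ × ℝ) := Measure.measurePreserving_swap
  have hassoc : MeasurePreserving (MeasurableEquiv.prodAssoc : (ℝ × ℝ) × ℝ ≃ᵐ ℝ × ℝ × ℝ) :=
    measurePreserving_prodAssoc volume volume volume
  have hlast : MeasurePreserving (Prod.map id (Prod.map (fun x => e * x) id) :
      ℝ × ℝ × ℝ → ℝ × ℝ × ℝ) := hid.prod ((measurePreserving_const_mul he).prod hid)
  have h1 : MeasurePreserving (Prod.map id fun x : EuclideanSpace ℝ (Fin 2) => (x 0, x 1) :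
      SpaceTime → ℝ × ℝ × ℝ) := hid.prod hP
  cases c
  · have hswap' : MeasurePreserving (Prod.swap : ℝ × ℝ × ℝ → (ℝ × ℝ) × ℝ) :=
      Measure.measurePreserving_swap
    exact hlast.comp (hassoc.comp (hswap'.comp h1))
  · exact hlast.comp (hassoc.comp ((hswap.prod hid).comp ((hassoc.symm).comp h1)))

/-- The contribution of one piece of the hyperboloid to the extension operator. -/
noncomputable def hypPieceExtension (c : Bool) (e : ℝ) (f : SpaceTime → ℂ) (z : SpaceTime) : ℂ :=
  ∫ ζ, Complex.exp (Complex.I * ((z.1 * ζ.1 + inner ℝ z.2 ζ.2 : ℝ) : ℂ)) * f ζ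
    ∂hypPieceMeasure c e

theorem hypPieceExtension_eq (c : Bool) (e : ℝ) {f : SpaceTime → ℂ} (hf : Measurable f) :
    hypPieceExtension c e f
      = hypOp ((hypDomain c).indicator fun w => f (hypPiece c e w)) ∘ hypPieceDual c e := by
  ext z
  have hm : Measurable fun ζ : SpaceTime =>
      Complex.exp (Complex.I * ((z.1 * ζ.1 + inner ℝ z.2 ζ.2 : ℝ) : ℂ)) * f ζ := by fun_prop
  rw [hypPieceExtension, hypPieceMeasure, integral_map (measurable_hypPiece c e).aemeasurable
    hm.aestronglyMeasurable, ← integral_indicator (measurableSet_hypDomain c),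
    Function.comp_apply, hypOp]
  congr 1
  ext w
  by_cases h : w ∈ hypDomain c
  · simp only [Set.indicator_of_mem h, phase_hypPiece]
  · simp only [Set.indicator_of_notMem h, mul_zero]

theorem hypExtension_eq_sum {f : SpaceTime → ℂ} (hf : Integrable f hypMeasure) :
    hypExtension f = (hypPieceExtension true (-1) f + hypPieceExtension true 1 f)
      + (hypPieceExtension false 1 f + hypPieceExtension false (-1) f) := by
  ext z
  have hi : Integrable (fun ζ : SpaceTime =>
      Complex.exp (Complex.I * ((z.1 * ζ.1 + inner ℝ z.2 ζ.2 : ℝ) : ℂ)) * f ζ) hypMeasure := by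
    refine hf.bdd_mul (c := 1) (by fun_prop) (.of_forall fun ζ => ?_)
    rw [mul_comm, Complex.norm_exp_ofReal_mul_I]
  rw [hypMeasure_eq_sum] at hi
  obtain ⟨h12, h34⟩ := integrable_add_measure.1 hi
  obtain ⟨h1, h2⟩ := integrable_add_measure.1 h12
  obtain ⟨h3, h4⟩ := integrable_add_measure.1 h34
  rw [hypExtension, hypMeasure_restrict_hyperboloid, hypMeasure_eq_sum,
    integral_add_measure h12 h34, integral_add_measure h1 h2, integral_add_measure h3 h4]
  rfl

theorem hypOp_eLpNorm_le {p : ℝ} (hp : 1 < p) (hp4 : p < 4) :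
    ∃ C : ℝ≥0, ∀ g : ℝ × ℝ → ℂ, Measurable g → Integrable g →
      MemLp g (ENNReal.ofReal p) volume →
      eLpNorm (hypOp g) (ENNReal.ofReal (3 * p / (p - 1))) volume
        ≤ C * eLpNorm g (ENNReal.ofReal p) volume := by
  obtain ⟨C, hC, h⟩ := hypOp_strong_type hp hp4
  have hp0 : 0 < p := by linarith
  have hp1 : 0 < p - 1 := by linarith
  have hq0 : 0 < 3 * p / (p - 1) := by positivity
  refine ⟨(C ^ (1 / (3 * p / (p - 1)))).toNNReal, fun g hg hi hmem => ?_⟩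
  have hp0' : ENNReal.ofReal p ≠ 0 := (ENNReal.ofReal_pos.2 hp0).ne'
  have hfin := lintegral_rpow_enorm_lt_top_of_eLpNorm_lt_top hp0' ENNReal.ofReal_ne_top hmem.2
  rw [ENNReal.toReal_ofReal hp0.le] at hfin
  rw [ENNReal.coe_toNNReal (ENNReal.rpow_ne_top_of_nonneg (by positivity) hC),
    eLpNorm_eq_lintegral_rpow_enorm_toReal hp0' ENNReal.ofReal_ne_top,
    eLpNorm_eq_lintegral_rpow_enorm_toReal (ENNReal.ofReal_pos.2 hq0).ne' ENNReal.ofReal_ne_top,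
    ENNReal.toReal_ofReal hp0.le, ENNReal.toReal_ofReal hq0.le]
  have e : 1 / p = 3 / (p - 1) * (1 / (3 * p / (p - 1))) := by field_simp
  rw [e, ENNReal.rpow_mul, ← ENNReal.mul_rpow_of_nonneg _ _ (by positivity)]
  exact ENNReal.rpow_le_rpow (h g hg hi hfin.ne) (by positivity)

theorem hypPieceMeasure_le {c : Bool} {e : ℝ} (he : e ^ 2 = 1) :
    hypPieceMeasure c e ≤ hypMeasure := by
  rw [hypMeasure_eq_sum]
  rcases sq_eq_one_iff.1 he with rfl | rfl <;> cases c
  · exact (Measure.le_add_right le_rfl).trans (Measure.le_add_left le_rfl)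
  · exact (Measure.le_add_left le_rfl).trans (Measure.le_add_right le_rfl)
  · exact (Measure.le_add_left le_rfl).trans (Measure.le_add_left le_rfl)
  · exact (Measure.le_add_right le_rfl).trans (Measure.le_add_right le_rfl)

theorem measurable_comp_hypPiece_indicator (c : Bool) (e : ℝ) {f : SpaceTime → ℂ}
    (hf : Measurable f) : Measurable ((hypDomain c).indicator fun w => f (hypPiece c e w)) :=
  (hf.comp (measurable_hypPiece c e)).indicator (measurableSet_hypDomain c)

theorem measurable_hypPieceExtension (c : Bool) {e : ℝ} (he : e ^ 2 = 1) {f : SpaceTime → ℂ}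
    (hf : Measurable f) : Measurable (hypPieceExtension c e f) := by
  rw [hypPieceExtension_eq c e hf]
  exact (stronglyMeasurable_hypOp (measurable_comp_hypPiece_indicator c e hf)).measurable.comp
    (measurePreserving_hypPieceDual c he).measurable

theorem eLpNorm_comp_hypPiece_indicator (c : Bool) (e : ℝ) {f : SpaceTime → ℂ}
    (hf : Measurable f) (p : ℝ≥0∞) :
    eLpNorm ((hypDomain c).indicator fun w => f (hypPiece c e w)) p volume
      = eLpNorm f p (hypPieceMeasure c e) := by
  rw [eLpNorm_indicator_eq_eLpNorm_restrict (measurableSet_hypDomain c), hypPieceMeasure,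
    eLpNorm_map_measure hf.aestronglyMeasurable (measurable_hypPiece c e).aemeasurable]
  rfl

theorem hypPieceExtension_eLpNorm_le {p : ℝ} (hp : 1 < p) (hp4 : p < 4) :
    ∃ C : ℝ≥0, ∀ (c : Bool) (e : ℝ), e ^ 2 = 1 → ∀ f : SpaceTime → ℂ, Measurable f →
      Integrable f hypMeasure → MemLp f (ENNReal.ofReal p) hypMeasure →
      eLpNorm (hypPieceExtension c e f) (ENNReal.ofReal (3 * p / (p - 1))) volume
        ≤ C * eLpNorm f (ENNReal.ofReal p) hypMeasure := by
  obtain ⟨C, hC⟩ := hypOp_eLpNorm_le hp hp4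
  refine ⟨C, fun c e he f hf hi hmem => ?_⟩
  have hgm := measurable_comp_hypPiece_indicator c e hf
  have hlp : ∀ r : ℝ≥0∞, eLpNorm ((hypDomain c).indicator fun w => f (hypPiece c e w)) r volume
      ≤ eLpNorm f r hypMeasure := fun r => by
    rw [eLpNorm_comp_hypPiece_indicator c e hf]
    exact eLpNorm_mono_measure f (hypPieceMeasure_le he)
  have hgi := memLp_one_iff_integrable.1
    ⟨hgm.aestronglyMeasurable, (hlp 1).trans_lt (memLp_one_iff_integrable.2 hi).2⟩
  rw [hypPieceExtension_eq c e hf, eLpNorm_comp_measurePreserving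
    (stronglyMeasurable_hypOp hgm).aestronglyMeasurable (measurePreserving_hypPieceDual c he)]
  refine (hC _ hgm hgi ⟨hgm.aestronglyMeasurable, (hlp _).trans_lt hmem.2⟩).trans ?_
  gcongr
  exact hlp _

/-- The triangle inequality over the four pieces, each of whose measures is at most `hypMeasure`. -/
theorem extensionEstimate_of_lt_four {p : ℝ} (hp : 1 < p) (hp4 : p < 4) :
    ExtensionEstimate (ENNReal.ofReal p) (ENNReal.ofReal (3 * p / (p - 1))) := by
  obtain ⟨C, hC⟩ := hypPieceExtension_eLpNorm_le hp hp4
  refine ⟨C + C + (C + C), fun f hf hfc => ?_⟩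
  have hfm : Measurable f := hf.continuous.measurable
  have hi : Integrable f hypMeasure := hf.continuous.integrable_of_hasCompactSupport hfc
  have hmem : MemLp f (ENNReal.ofReal p) hypMeasure :=
    hf.continuous.memLp_of_hasCompactSupport hfc
  have hq1 : 1 ≤ ENNReal.ofReal (3 * p / (p - 1)) := by
    rw [ENNReal.one_le_ofReal, le_div_iff₀ (by linarith)]
    linarith
  have hm : ∀ (c : Bool) (e : ℝ), e ^ 2 = 1 →
      AEStronglyMeasurable (hypPieceExtension c e f) volume := fun c e he =>
    (measurable_hypPieceExtension c he hfm).aestronglyMeasurable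
  have h1 : (1 : ℝ) ^ 2 = 1 := by norm_num
  have h2 : (-1 : ℝ) ^ 2 = 1 := by norm_num
  rw [hypExtension_eq_sum hi, hypMeasure_restrict_hyperboloid]
  refine (eLpNorm_add_le ((hm _ _ h2).add (hm _ _ h1)) ((hm _ _ h1).add (hm _ _ h2)) hq1).trans ?_
  refine (add_le_add (eLpNorm_add_le (hm _ _ h2) (hm _ _ h1) hq1)
    (eLpNorm_add_le (hm _ _ h1) (hm _ _ h2) hq1)).trans ?_
  push_cast
  simp only [add_mul]
  gcongr <;> exact hC _ _ (by norm_num) f hfm hi hmem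

theorem extensionEstimate_one_top : ExtensionEstimate 1 ⊤ := by
  refine ⟨1, fun f _ _ => ?_⟩
  rw [ENNReal.coe_one, one_mul, eLpNorm_exponent_top, eLpNorm_one_eq_lintegral_enorm]
  refine essSup_le_of_ae_le _ (.of_forall fun z => ?_)
  refine (enorm_integral_le_lintegral_enorm _).trans (lintegral_mono fun ζ => ?_)
  rw [enorm_mul, enorm_exp_I_mul_ofReal, one_mul]

theorem proposition3p1 (p p' q : ℝ≥0∞) (hpp' : ENNReal.HolderConjugate p p')
    (hq : q = 3 * p') (hpq : p ≤ q) (hne : (p, q) ≠ (4, 4)) :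
    ExtensionEstimate p q := by
  have hp1 : 1 ≤ p := ENNReal.HolderConjugate.one_le p p'
  rcases hp1.eq_or_lt with rfl | hp1
  · obtain rfl : p' = ⊤ := (ENNReal.HolderConjugate.eq_top_iff_eq_one p' 1).2 rfl
    rw [hq, ENNReal.mul_top (by norm_num)]
    exact extensionEstimate_one_top
  have hp'top : p' ≠ ⊤ := fun h =>
    hp1.ne' ((ENNReal.HolderConjugate.eq_top_iff_eq_one p' p).1 h)
  have hptop : p ≠ ⊤ := by
    rintro rfl
    have := ENNReal.mul_ne_top (a := 3) (by norm_num) hp'top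
    exact this (hq ▸ top_le_iff.1 hpq)
  have hconj := ENNReal.HolderConjugate.toReal_of_ne_top hptop hp'top
  lift p to ℝ≥0 using hptop
  lift p' to ℝ≥0 using hp'top
  have hp1' : (1 : ℝ) < p := hconj.lt
  have hp'eq : (p' : ℝ) = p / (p - 1) := hconj.conjugate_eq
  have hqeq : q = ENNReal.ofReal (3 * p / (p - 1)) := by
    rw [hq, mul_div_assoc, ← hp'eq, ENNReal.ofReal_mul (by norm_num), ENNReal.ofReal_coe_nnreal]
    norm_num
  have hle : (p : ℝ) ≤ 3 * p / (p - 1) := by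
    rw [hqeq, ← ENNReal.ofReal_coe_nnreal] at hpq
    refine (ENNReal.ofReal_le_ofReal_iff ?_).1 hpq
    have : 0 < (p : ℝ) - 1 := by linarith
    positivity
  rw [le_div_iff₀ (by linarith)] at hle
  -- With `q = 3p/(p - 1)`, the condition `p ≤ q` reads `p ≤ 4`, and `p = 4` would force `q = 4`,
  -- the excluded endpoint.
  have hp4 : (p : ℝ) < 4 := by
    refine lt_of_le_of_ne (by nlinarith) fun h => hne ?_
    rw [hqeq, h, ← ENNReal.ofReal_coe_nnreal, h]
    norm_num
  rw [hqeq, ← ENNReal.ofReal_coe_nnreal]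
  exact extensionEstimate_of_lt_four hp1' hp4
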